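/- For $x\in\mathbb{R}$ put $\langle x\rangle=(1+x^2)^{1/2}$. For a tempered distribution $z$ on $\mathbb{R}_x\times\mathbb{R}_t$ (complex valued) let $\hat z(\xi,\tau)$ be its space-time Fourier transform, $\hat z(\xi,\tau)=\iint e^{-i(x\xi+t\tau)}z(x,t)\,dx\,dt$ for Schwartz $z$. For $\alpha\in\mathbb{R}$ let $X^S_{0,\alpha}$ and $X^{W_\pm}_{-1/2,\alpha}$ be the spaces of tempered distributions $z$ for which $\hat z$ is a function and the respective norm $$\|z\|_{X^S_{0,\alpha}}=\Big(\iint\langle\tau+|\xi|^2\rangle^{2\alpha}|\hat z(\xi,\tau)|^2\,d\xi\,d\tau\Big)^{1/2},\qquad \|z\|_{X^{W_\pm}_{-1/2,\alpha}}=\Big(\iint\langle\xi\rangle^{-1}\langle\tau\pm\xi\rangle^{2\alpha}|\hat z(\xi,\tau)|^2\,d\xi\,d\tau\Big)^{1/2}$$ is finite. (1) Let $\tfrac14<b,b_1,c_1<\tfrac12$ and $b+b_1+c_1\ge1$. There is a constant $C$, depending only on $b,b_1,c_1$, such that for either choice of the sign $\pm$ and all $n_\pm\in X^{W_\pm}_{-1/2,b}$,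 $u\in X^S_{0,b_1}$, the product $n_\pm u$ is well defined and $$\|n_\pm u\|_{X^S_{0,-c_1}}\le C\,\|n_\pm\|_{X^{W_\pm}_{-1/2,b}}\,\|u\|_{X^S_{0,b_1}}.$$ (2) Let $\tfrac14<b_1,c<\tfrac12$ and $2b_1+c\ge1$. There is a constant $C$, depending only on $b_1,c$, such that for either choice of the sign $\pm$ and all $u_1,u_2\in X^S_{0,b_1}$, the product $u_1\bar u_2$ is well defined and $$\|\partial_x(u_1\bar u_2)\|_{X^{W_\pm}_{-1/2,-c}}\le C\,\|u_1\|_{X^S_{0,b_1}}\,\|u_2\|_{X^S_{0,b_1}}.$$ Here the products $n_\pm u$ and $u_1\bar u_2$ are the extensions by continuity of the pointwise products of Schwartz functions: the factors can be approximated by Schwartz functions in the norms on the right-hand side, and for all such approximations the pointwise products converge, as tempered distributions, to the same limit, which is the product. The derivative $\partial_x$ is taken in the sense of distributions. -/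

import Mathlib

open MeasureTheory Filter Topology
open scoped SchwartzMap ENNReal NNReal FourierTransform LineDeriv

noncomputable section

namespace Zakharov

/-- The Japanese bracket `⟨x⟩ = (1 + |x|²)^{1/2}`. -/
def bracket (x : ℝ) : ℝ := Real.sqrt (1 + x ^ 2)

/-- The change of variables `(ξ, τ) ↦ (ξ, τ) / (2π)`. -/
def angularScale : (ℝ × ℝ) ≃L[ℝ] (ℝ × ℝ) :=
  ContinuousLinearEquiv.smulLeft
    (Units.mk0 ((2 * Real.pi)⁻¹) (inv_ne_zero Real.two_pi_pos.ne'))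

/-- The space-time Fourier transform of Schwartz functions on `ℝ × ℝ` in angular frequency,
`φ̂(ξ, τ) = ∬ e^{-i(xξ + tτ)} φ(x, t) dx dt` (see `fourierST_apply`). -/
def fourierST : 𝓢(ℝ × ℝ, ℂ) →L[ℂ] 𝓢(ℝ × ℝ, ℂ) :=
  (SchwartzMap.compCLMOfContinuousLinearEquiv ℂ
      (angularScale.trans (WithLp.prodContinuousLinearEquiv 2 ℝ ℝ ℝ).symm)).comp
    ((FourierTransform.fourierCLM ℂ 𝓢(WithLp 2 (ℝ × ℝ), ℂ)).comp
      (SchwartzMap.compCLMOfContinuousLinearEquiv ℂ (WithLp.prodContinuousLinearEquiv 2 ℝ ℝ ℝ)))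

theorem fourierST_apply (φ : 𝓢(ℝ × ℝ, ℂ)) (ξ τ : ℝ) :
    fourierST φ (ξ, τ) =
      ∫ p : ℝ × ℝ, Complex.exp (-Complex.I * ((p.1 * ξ + p.2 * τ : ℝ) : ℂ)) * φ p := by
  have h : fourierST φ (ξ, τ) =
      𝓕 (fun q : WithLp 2 (ℝ × ℝ) => φ q.ofLp)
        (WithLp.toLp 2 ((2 * Real.pi)⁻¹ * ξ, (2 * Real.pi)⁻¹ * τ)) := rfl
  rw [h, Real.fourier_eq']
  rw [← (WithLp.volume_preserving_toLp ℝ ℝ).integral_comp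
    (MeasurableEquiv.toLp 2 (ℝ × ℝ)).measurableEmbedding]
  refine integral_congr_ae (Eventually.of_forall fun p => ?_)
  simp only [WithLp.prod_inner_apply, smul_eq_mul]
  congr 2
  have hpi : (Real.pi : ℂ) ≠ 0 := by exact_mod_cast Real.pi_ne_zero
  simp
  field_simp

/-- The tempered distribution `z` has as its space-time Fourier transform the function `f`:
`⟨z, φ̂⟩ = ∬ f φ dξ dτ` for all Schwartz functions `φ`. Such an `f` is unique up to
almost everywhere equality. -/
def HasFourier (z : 𝓢'(ℝ × ℝ, ℂ)) (f : ℝ × ℝ → ℂ) : Prop :=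
  AEStronglyMeasurable f volume ∧
    ∀ φ : 𝓢(ℝ × ℝ, ℂ), Integrable (fun p => f p * φ p) volume ∧
      z (fourierST φ) = ∫ p, f p * φ p

/-- `(∬ w(ξ, τ) |ẑ(ξ, τ)|² dξ dτ)^{1/2}` in `[0, ∞]`. The infimum is over the (a.e. unique) function
representing `ẑ`, so the value is `∞` if `ẑ` is not a function. -/
def fourierWeightedNorm (w : ℝ × ℝ → ℝ) (z : 𝓢'(ℝ × ℝ, ℂ)) : ℝ≥0∞ :=
  ⨅ (f : ℝ × ℝ → ℂ) (_ : HasFourier z f),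
    (∫⁻ p : ℝ × ℝ, ENNReal.ofReal (w p) * ‖f p‖ₑ ^ 2) ^ (1 / 2 : ℝ)

/-- The norm of the Schrödinger-Bourgain space `X^S_{0,α}`. The space consists of the tempered
distributions for which it is finite. -/
def normXS (α : ℝ) : 𝓢'(ℝ × ℝ, ℂ) → ℝ≥0∞ :=
  fourierWeightedNorm fun p => bracket (p.2 + |p.1| ^ 2) ^ (2 * α)

/-- The norm of the reduced-wave-Bourgain space `X^{W±}_{-1/2,α}`, where `ε = 1` is the sign `+` and
`ε = -1` the sign `-`. The space consists of the tempered distributions for which it is finite. -/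
def normXW (ε : ℝ) (α : ℝ) : 𝓢'(ℝ × ℝ, ℂ) → ℝ≥0∞ :=
  fourierWeightedNorm fun p => bracket p.1 ^ (-1 : ℝ) * bracket (p.2 + ε * p.1) ^ (2 * α)

/-- Let `N`, `M` be norms on spaces of tempered distributions and let `B` be an operation on complex
numbers (below `B a b = a * b` or `B a b = a * conj b`). Then `w` is the product `B(u, v)`, where
`B` is extended by continuity from Schwartz functions, on which it acts pointwise: `u`, `v` can be
approximated by Schwartz functions in the norms `N`, `M`, and for all such approximations
`aₖ → u`, `bₖ → v` one has `B(aₖ, bₖ) → w` in the sense of tempered distributions. -/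
def IsProduct (B : ℂ → ℂ → ℂ) (N M : 𝓢'(ℝ × ℝ, ℂ) → ℝ≥0∞) (u v w : 𝓢'(ℝ × ℝ, ℂ)) : Prop :=
  (∃ a : ℕ → 𝓢(ℝ × ℝ, ℂ), Tendsto (fun k => N ((a k : 𝓢'(ℝ × ℝ, ℂ)) - u)) atTop (𝓝 0)) ∧
  (∃ b : ℕ → 𝓢(ℝ × ℝ, ℂ), Tendsto (fun k => M ((b k : 𝓢'(ℝ × ℝ, ℂ)) - v)) atTop (𝓝 0)) ∧
  ∀ a b : ℕ → 𝓢(ℝ × ℝ, ℂ),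
    Tendsto (fun k => N ((a k : 𝓢'(ℝ × ℝ, ℂ)) - u)) atTop (𝓝 0) →
    Tendsto (fun k => M ((b k : 𝓢'(ℝ × ℝ, ℂ)) - v)) atTop (𝓝 0) →
    ∀ φ : 𝓢(ℝ × ℝ, ℂ),
      Tendsto (fun k => ∫ p : ℝ × ℝ, B (a k p) (b k p) * φ p) atTop (𝓝 (w φ))

theorem IsProduct.unique {B : ℂ → ℂ → ℂ} {N M : 𝓢'(ℝ × ℝ, ℂ) → ℝ≥0∞}
    {u v w w' : 𝓢'(ℝ × ℝ, ℂ)} (h : IsProduct B N M u v w) (h' : IsProduct B N M u v w') :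
    w = w' := by
  obtain ⟨⟨a, ha⟩, ⟨b, hb⟩, H⟩ := h
  ext φ
  exact tendsto_nhds_unique (H a b ha hb φ) (h'.2.2 a b ha hb φ)

/-- `w = n u`, for `n` in `X^{W±}_{-1/2,b}` and `u` in `X^S_{0,b₁}`. -/
def IsWaveSchrodingerProduct (ε b b₁ : ℝ) (n u w : 𝓢'(ℝ × ℝ, ℂ)) : Prop :=
  IsProduct (fun y z => y * z) (normXW ε b) (normXS b₁) n u w

/-- `w = u₁ ū₂`, for `u₁` and `u₂` in `X^S_{0,b₁}`. -/
def IsSchrodingerConjProduct (b₁ : ℝ) (u₁ u₂ w : 𝓢'(ℝ × ℝ, ℂ)) : Prop :=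
  IsProduct (fun y z => y * (starRingEnd ℂ) z) (normXS b₁) (normXS b₁) u₁ u₂ w

/-- The distributional derivative `∂ₓ` in the first variable of `(x, t)`. -/
def partialX (z : 𝓢'(ℝ × ℝ, ℂ)) : 𝓢'(ℝ × ℝ, ℂ) := ∂_{((1, 0) : ℝ × ℝ)} z

end Zakharov

end

/-!
Both estimates follow from one trilinear estimate on the Fourier side,
`∬ f(P) g(Q) h(P + Q) ≤ C ‖f‖ ‖g‖ ‖h‖`, with the norm of `X^{W±}_{-1/2,b}` on `f` and those of
`X^S_{0,b₁}`, `X^S_{0,c}` on `g`, `h` (`exists_trilinear_le`). By duality in `h` it bounds `n u` in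
`X^S_{0,-c}`. By duality in `f` it bounds the Fourier transform of `u₁ ū₂` in the dual of
`X^{W±}_{-1/2,c}`, whose weight `⟨ξ⟩⟨τ ± ξ⟩^{-2c}` is at least `|ξ|²⟨ξ⟩⁻¹⟨τ ± ξ⟩^{-2c}`, which is
what `∂ₓ` requires.

For the trilinear estimate one may assume `b + b₁ + c = 1` (`exists_exponents_le`). By the
Cauchy-Schwarz inequality with one of the three variables fixed (`lintegral_lintegral_sqrt_le`), it
is enough to bound, uniformly in that variable, the integral over the others of the squared
multiplier `⟨ξ⟩⟨σ₁⟩^{-2b}⟨σ₂⟩^{-2b₁}⟨σ₃⟩^{-2c}`, where `ξ` is the wave frequency, `σ₁ = τ ± ξ` is the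
modulation of `P`, and `σ₂`, `σ₃` are the modulations `τ + ξ²` of `Q` and `P + Q`. The fixed variable
is that of the largest modulation `s`. The integral over `τ` is a convolution of two powers, and
leaves `|σ|^{-a}` with `σ` the combination of the two other modulations in which `τ` cancels
(`exists_lintegral_enorm_rpow_conv_le`). In the remaining frequency `y`, `σ` is a polynomial: affine
of slope `2ξ` if the wave variable is fixed, which compensates the factor `⟨ξ⟩`
(`exists_lintegral_enorm_linear_rpow_le`); otherwise quadratic. Then completing the square gives
`σ = s - Y² + y²` with `ξ = ±(Y - y)`, and `|σ| ≲ ⟨s⟩` gives `|ξ| ≲ |y| + ⟨s⟩^{1/2}`. For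
`|y| ≥ ⟨s⟩^{1/2}` the factor `|y|` is absorbed by the change of variables `v = y²`, and for
`|y| ≤ ⟨s⟩^{1/2}` the integral of `|y² - M|^{-a}` is bounded uniformly in `M` by scaling, as
`a < 1/2` (`exists_lintegral_bracket_sub_mul_enorm_rpow_le`). In each case the bound is a power of
`⟨s⟩` that the weight of the fixed variable compensates exactly. Wave frequencies `|ξ| ≤ 1` need no
lower bound on the fixed modulation, and are integrated over an interval of length `2` with the
variable `P + Q` fixed. The value of the wave speed `±1` plays no role.

The trilinear form is continuous in the weighted `L²` norms and represents the product of Schwartz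
functions, which are dense, so it defines the product as a tempered distribution
(`TrilinearBound.exists_isProduct`).
-/

noncomputable section

namespace Zakharov

/-! ### Power integrals on the line -/

theorem enorm_rpow_neg_eq_ofReal {x : ℝ} (hx : 0 < x) (θ : ℝ) :
    ‖x‖ₑ ^ (-θ) = ENNReal.ofReal (x ^ (-θ)) := by
  rw [← ENNReal.ofReal_rpow_of_pos hx, Real.enorm_of_nonneg hx.le]

theorem measurable_enorm_rpow (θ : ℝ) : Measurable fun x : ℝ => ‖x‖ₑ ^ θ :=
  measurable_enorm.pow_const θ

theorem lintegral_Ioc_enorm_rpow {θ R : ℝ} (hθ : θ < 1) (hR : 0 < R) :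
    ∫⁻ x in Set.Ioc 0 R, ‖x‖ₑ ^ (-θ) = ENNReal.ofReal (R ^ (1 - θ) / (1 - θ)) := by
  have h1 : ∫⁻ x in Set.Ioc 0 R, ‖x‖ₑ ^ (-θ) = ∫⁻ x in Set.Ioc 0 R, ENNReal.ofReal (x ^ (-θ)) :=
    setLIntegral_congr_fun measurableSet_Ioc fun x hx => enorm_rpow_neg_eq_ofReal hx.1 θ
  have hi : IntervalIntegrable (fun x : ℝ => x ^ (-θ)) volume 0 R :=
    intervalIntegral.intervalIntegrable_rpow' (by linarith)
  rw [h1, ← ofReal_integral_eq_lintegral_ofReal]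
  · rw [← intervalIntegral.integral_of_le hR.le, integral_rpow (Or.inl (by linarith)),
      Real.zero_rpow (by linarith)]
    congr 1
    rw [sub_zero, show -θ + 1 = 1 - θ by ring]
  · exact (intervalIntegrable_iff_integrableOn_Ioc_of_le hR.le).1 hi
  · exact (ae_restrict_iff' measurableSet_Ioc).2 (Eventually.of_forall fun x hx =>
      Real.rpow_nonneg hx.1.le _)

theorem lintegral_Ioi_enorm_rpow {θ R : ℝ} (hθ : 1 < θ) (hR : 0 < R) :
    ∫⁻ x in Set.Ioi R, ‖x‖ₑ ^ (-θ) = ENNReal.ofReal (R ^ (1 - θ) / (θ - 1)) := by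
  have h1 : ∫⁻ x in Set.Ioi R, ‖x‖ₑ ^ (-θ) = ∫⁻ x in Set.Ioi R, ENNReal.ofReal (x ^ (-θ)) :=
    setLIntegral_congr_fun measurableSet_Ioi fun x hx => enorm_rpow_neg_eq_ofReal (hR.trans hx) θ
  rw [h1, ← ofReal_integral_eq_lintegral_ofReal]
  · rw [integral_Ioi_rpow_of_lt (by linarith) hR]
    congr 1
    rw [show -θ + 1 = -(θ - 1) by ring, show 1 - θ = -(θ - 1) by ring, neg_div_neg_eq]
  · exact integrableOn_Ioi_rpow_of_lt (by linarith) hR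
  · exact (ae_restrict_iff' measurableSet_Ioi).2 (Eventually.of_forall fun x hx =>
      Real.rpow_nonneg (hR.trans hx).le _)

theorem lintegral_eq_two_mul_of_even {g : ℝ → ℝ≥0∞} (hg : Measurable g)
    (heven : ∀ x, g (-x) = g x) : ∫⁻ x, g x = 2 * ∫⁻ x in Set.Ioi 0, g x := by
  have h1 : ∫⁻ x in Set.Iio 0, g x = ∫⁻ x in Set.Ioi 0, g x := by
    have := (Measure.measurePreserving_neg (volume : Measure ℝ)).setLIntegral_comp_preimage
      (measurableSet_Iio (a := (0 : ℝ))) hg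
    rw [← this]
    simp [heven]
  rw [← lintegral_add_compl g (measurableSet_Iio (a := (0 : ℝ))), Set.compl_Iio,
    setLIntegral_congr Ioi_ae_eq_Ici.symm, h1, two_mul]

theorem lintegral_ball_enorm_rpow {θ R : ℝ} (hθ : θ < 1) (hR : 0 < R) :
    ∫⁻ x in Metric.closedBall (0 : ℝ) R, ‖x‖ₑ ^ (-θ) ≤
      ENNReal.ofReal (2 / (1 - θ)) * ENNReal.ofReal R ^ (1 - θ) := by
  rw [← lintegral_indicator Metric.isClosed_closedBall.measurableSet,
    lintegral_eq_two_mul_of_even]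
  · rw [setLIntegral_indicator Metric.isClosed_closedBall.measurableSet]
    have : Metric.closedBall (0 : ℝ) R ∩ Set.Ioi 0 = Set.Ioc 0 R := by
      ext x; simp only [Set.mem_inter_iff, Metric.mem_closedBall, dist_zero_right, Set.mem_Ioi,
        Real.norm_eq_abs, abs_le, Set.mem_Ioc]
      constructor
      · rintro ⟨h, h'⟩; exact ⟨h', h.2⟩
      · rintro ⟨h, h'⟩; exact ⟨⟨by linarith, h'⟩, h⟩
    rw [this, lintegral_Ioc_enorm_rpow hθ hR, ENNReal.ofReal_rpow_of_pos hR,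
      ← ENNReal.ofReal_mul (by apply div_nonneg <;> linarith),
      show (2 : ℝ≥0∞) = ENNReal.ofReal 2 by simp, ← ENNReal.ofReal_mul (by norm_num)]
    apply le_of_eq; congr 1; ring
  · exact (measurable_enorm_rpow _).indicator Metric.isClosed_closedBall.measurableSet
  · intro x; simp [Set.indicator]

theorem lintegral_compl_ball_enorm_rpow {θ R : ℝ} (hθ : 1 < θ) (hR : 0 < R) :
    ∫⁻ x in (Metric.closedBall (0 : ℝ) R)ᶜ, ‖x‖ₑ ^ (-θ) ≤
      ENNReal.ofReal (2 / (θ - 1)) * ENNReal.ofReal R ^ (1 - θ) := by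
  have hm := (Metric.isClosed_closedBall (x := (0 : ℝ)) (ε := R)).measurableSet.compl
  rw [← lintegral_indicator hm, lintegral_eq_two_mul_of_even]
  · rw [setLIntegral_indicator hm]
    have : (Metric.closedBall (0 : ℝ) R)ᶜ ∩ Set.Ioi 0 = Set.Ioi R := by
      ext x; simp only [Set.mem_inter_iff, Metric.mem_closedBall, dist_zero_right, Set.mem_Ioi,
        Real.norm_eq_abs, abs_le, Set.mem_compl_iff, not_and, not_le]
      constructor
      · rintro ⟨h, h'⟩; exact h (by linarith)
      · intro h; exact ⟨fun _ => h, by linarith⟩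
    rw [this, lintegral_Ioi_enorm_rpow hθ hR, ENNReal.ofReal_rpow_of_pos hR,
      ← ENNReal.ofReal_mul (by apply div_nonneg <;> linarith),
      show (2 : ℝ≥0∞) = ENNReal.ofReal 2 by simp, ← ENNReal.ofReal_mul (by norm_num)]
    apply le_of_eq; congr 1; ring
  · exact (measurable_enorm_rpow _).indicator hm
  · intro x; simp [Set.indicator]

theorem enorm_rpow_neg_le {x R θ : ℝ} (hθ : 0 ≤ θ) (h : R ≤ |x|) :
    ‖x‖ₑ ^ (-θ) ≤ ENNReal.ofReal R ^ (-θ) := by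
  rw [ENNReal.rpow_neg, ENNReal.rpow_neg, ENNReal.inv_le_inv]
  gcongr
  rw [Real.enorm_eq_ofReal_abs]
  exact ENNReal.ofReal_le_ofReal h

/-- Local integrals of `|x - m|^{-θ}` over intervals of length `2R` scale like `R^{1-θ}`, uniformly
in the position of the singularity. -/
theorem exists_lintegral_ball_enorm_sub_rpow_le {θ : ℝ} (hθ0 : 0 ≤ θ) (hθ : θ < 1) :
    ∃ C : ℝ≥0, ∀ c m R : ℝ, 0 < R → ∫⁻ x in Metric.closedBall c R, ‖x - m‖ₑ ^ (-θ) ≤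
      C * ENNReal.ofReal R ^ (1 - θ) := by
  refine ⟨(2 / (1 - θ)).toNNReal + 2, fun c m R hR => ?_⟩
  have hball := (Metric.isClosed_closedBall (x := (0 : ℝ)) (ε := R)).measurableSet
  have hR0 : ENNReal.ofReal R ≠ 0 := by simpa using hR
  have key : ∀ x, ‖x - m‖ₑ ^ (-θ) ≤ (Metric.closedBall (0 : ℝ) R).indicator
      (fun x => ‖x‖ₑ ^ (-θ)) (x - m) + ENNReal.ofReal R ^ (-θ) := by
    intro x
    by_cases h : x - m ∈ Metric.closedBall (0 : ℝ) R
    · rw [Set.indicator_of_mem h]; exact le_self_add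
    · refine le_add_left (enorm_rpow_neg_le hθ0 ?_)
      simp only [Metric.mem_closedBall, dist_zero_right, not_le, Real.norm_eq_abs] at h
      exact h.le
  calc ∫⁻ x in Metric.closedBall c R, ‖x - m‖ₑ ^ (-θ)
      ≤ ∫⁻ x in Metric.closedBall c R, ((Metric.closedBall (0 : ℝ) R).indicator
      (fun x => ‖x‖ₑ ^ (-θ)) (x - m) + ENNReal.ofReal R ^ (-θ)) := lintegral_mono key
    _ ≤ (∫⁻ x, (Metric.closedBall (0 : ℝ) R).indicator (fun x => ‖x‖ₑ ^ (-θ)) (x - m)) +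
        ENNReal.ofReal R ^ (-θ) * (2 * ENNReal.ofReal R) := by
      rw [lintegral_add_right _ measurable_const]
      refine add_le_add (setLIntegral_le_lintegral _ _) (le_of_eq ?_)
      · rw [lintegral_const, Measure.restrict_apply_univ, Real.volume_closedBall,
          ENNReal.ofReal_mul (by norm_num)]
        simp
    _ ≤ ENNReal.ofReal (2 / (1 - θ)) * ENNReal.ofReal R ^ (1 - θ) +
        2 * ENNReal.ofReal R ^ (1 - θ) := by
      refine add_le_add ?_ ?_
      · rw [lintegral_sub_right_eq_self, lintegral_indicator hball]
        exact lintegral_ball_enorm_rpow hθ hR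
      · rw [sub_eq_neg_add, ENNReal.rpow_add _ _ hR0 ENNReal.ofReal_ne_top, ENNReal.rpow_one]
        apply le_of_eq; ring
    _ = _ := by
      rw [ENNReal.coe_add, add_mul]; rfl

/-- Convolution of two homogeneous singularities `|t|^{-α} ⋆ |t|^{-β}`. -/
theorem exists_lintegral_enorm_rpow_conv_le {α β : ℝ} (hα0 : 0 ≤ α) (hα : α < 1) (hβ0 : 0 ≤ β)
    (hβ : β < 1) (hαβ : 1 < α + β) :
    ∃ C : ℝ≥0, ∀ A : ℝ, ∫⁻ t, ‖t‖ₑ ^ (-α) * ‖t - A‖ₑ ^ (-β) ≤ C * ‖A‖ₑ ^ (-(α + β - 1)) := by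
  set a := α + β - 1 with ha
  refine ⟨((2 / (1 - α)).toNNReal + (2 / (1 - β)).toNNReal + 2 * (2 / (α + β - 1)).toNNReal) *
    (2 : ℝ≥0) ^ a + 1, fun A => ?_⟩
  rcases eq_or_ne A 0 with rfl | hA
  · rw [enorm_zero, ENNReal.zero_rpow_of_neg (by linarith), ENNReal.mul_top]
    · exact le_top
    · rw [ENNReal.coe_add]; simp
  set R := |A| / 2 with hRdef
  have hR : 0 < R := by positivity
  have hR0 : ENNReal.ofReal R ≠ 0 := by simpa using hR
  have hball := (Metric.isClosed_closedBall (x := (0 : ℝ)) (ε := R)).measurableSet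
  set b := Metric.closedBall (0 : ℝ) R
  have mem : ∀ x, x ∈ b ↔ |x| ≤ R := fun x => by simp [b]
  set Fα : ℝ → ℝ≥0∞ := b.indicator fun x => ‖x‖ₑ ^ (-α)
  set Fβ : ℝ → ℝ≥0∞ := b.indicator fun x => ‖x‖ₑ ^ (-β)
  set G : ℝ → ℝ≥0∞ := bᶜ.indicator fun x => ‖x‖ₑ ^ (-(α + β))
  have mα : Measurable Fα := (measurable_enorm_rpow _).indicator hball
  have mβ : Measurable Fβ := (measurable_enorm_rpow _).indicator hball
  have mG : Measurable G := (measurable_enorm_rpow _).indicator hball.compl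
  have key : ∀ t, ‖t‖ₑ ^ (-α) * ‖t - A‖ₑ ^ (-β) ≤ Fα t * ENNReal.ofReal R ^ (-β) +
      ENNReal.ofReal R ^ (-α) * Fβ (t - A) + (G t + G (t - A)) := by
    intro t
    have tri : |A| ≤ |t| + |t - A| := by
      have := abs_sub t (t - A); simpa using this
    by_cases h1 : |t| ≤ R
    · refine le_add_right (le_add_right ?_)
      rw [show Fα t = ‖t‖ₑ ^ (-α) from Set.indicator_of_mem ((mem t).2 h1) _]
      refine mul_le_mul_right ?_ _
      exact enorm_rpow_neg_le hβ0 (by linarith)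
    by_cases h2 : |t - A| ≤ R
    · refine le_add_right (le_add_left ?_)
      rw [show Fβ (t - A) = ‖t - A‖ₑ ^ (-β) from Set.indicator_of_mem ((mem _).2 h2) _]
      refine mul_le_mul_left ?_ _
      exact enorm_rpow_neg_le hα0 (by linarith)
    refine le_add_left ?_
    rw [show G t = ‖t‖ₑ ^ (-(α + β)) from
        Set.indicator_of_mem (s := bᶜ) (fun h => h1 ((mem t).1 h)) _,
      show G (t - A) = ‖t - A‖ₑ ^ (-(α + β)) from
        Set.indicator_of_mem (s := bᶜ) (fun h => h2 ((mem _).1 h)) _]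
    have hx : ∀ x : ℝ, ¬ |x| ≤ R → ‖x‖ₑ ^ (-(α + β)) = ‖x‖ₑ ^ (-α) * ‖x‖ₑ ^ (-β) := by
      intro x hx
      rw [neg_add, ENNReal.rpow_add _ _ _ enorm_ne_top]
      simp only [ne_eq, enorm_eq_zero]
      rintro rfl
      simp at hx; linarith
    rw [hx t h1, hx _ h2]
    rcases le_total |t| |t - A| with h | h
    · refine le_add_right ?_
      refine mul_le_mul_right ?_ _
      rw [Real.enorm_eq_ofReal_abs t]
      exact enorm_rpow_neg_le hβ0 h
    · refine le_add_left ?_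
      refine mul_le_mul_left ?_ _
      rw [Real.enorm_eq_ofReal_abs (t - A)]
      exact enorm_rpow_neg_le hα0 h
  have hpow : ∀ x y : ℝ, ENNReal.ofReal R ^ x * ENNReal.ofReal R ^ y =
      ENNReal.ofReal R ^ (x + y) := fun x y =>
    (ENNReal.rpow_add _ _ hR0 ENNReal.ofReal_ne_top).symm
  calc ∫⁻ t, ‖t‖ₑ ^ (-α) * ‖t - A‖ₑ ^ (-β)
      ≤ ∫⁻ t, (Fα t * ENNReal.ofReal R ^ (-β) +
      ENNReal.ofReal R ^ (-α) * Fβ (t - A) + (G t + G (t - A))) := lintegral_mono key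
    _ = (∫⁻ t, Fα t) * ENNReal.ofReal R ^ (-β) + ENNReal.ofReal R ^ (-α) * (∫⁻ t, Fβ t) +
        ((∫⁻ t, G t) + (∫⁻ t, G t)) := by
      rw [lintegral_add_right _ (by fun_prop), lintegral_add_right _ (by fun_prop),
        lintegral_add_right _ (by fun_prop), lintegral_mul_const _ mα,
        lintegral_const_mul _ (by fun_prop), lintegral_sub_right_eq_self (fun t => Fβ t),
        lintegral_sub_right_eq_self (fun t => G t)]
    _ ≤ (ENNReal.ofReal (2 / (1 - α)) * ENNReal.ofReal R ^ (1 - α)) * ENNReal.ofReal R ^ (-β) +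
        ENNReal.ofReal R ^ (-α) * (ENNReal.ofReal (2 / (1 - β)) * ENNReal.ofReal R ^ (1 - β)) +
        (ENNReal.ofReal (2 / (α + β - 1)) * ENNReal.ofReal R ^ (1 - (α + β)) +
        ENNReal.ofReal (2 / (α + β - 1)) * ENNReal.ofReal R ^ (1 - (α + β))) := by
      have h1 : ∫⁻ t, Fα t ≤ ENNReal.ofReal (2 / (1 - α)) * ENNReal.ofReal R ^ (1 - α) := by
        rw [lintegral_indicator hball]; exact lintegral_ball_enorm_rpow hα hR
      have h2 : ∫⁻ t, Fβ t ≤ ENNReal.ofReal (2 / (1 - β)) * ENNReal.ofReal R ^ (1 - β) := by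
        rw [lintegral_indicator hball]; exact lintegral_ball_enorm_rpow hβ hR
      have h3 : ∫⁻ t, G t ≤ ENNReal.ofReal (2 / (α + β - 1)) *
          ENNReal.ofReal R ^ (1 - (α + β)) := by
        rw [lintegral_indicator hball.compl]; exact lintegral_compl_ball_enorm_rpow hαβ hR
      gcongr
    _ = (ENNReal.ofReal (2 / (1 - α)) + ENNReal.ofReal (2 / (1 - β)) +
          2 * ENNReal.ofReal (2 / (α + β - 1))) * ENNReal.ofReal R ^ (-a) := by
      rw [mul_assoc, hpow, mul_left_comm, hpow, show 1 - α + -β = -a by rw [ha]; ring,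
        show -α + (1 - β) = -a by rw [ha]; ring, show 1 - (α + β) = -a by rw [ha]; ring]
      ring
    _ = (ENNReal.ofReal (2 / (1 - α)) + ENNReal.ofReal (2 / (1 - β)) +
          2 * ENNReal.ofReal (2 / (α + β - 1))) * 2 ^ a * ‖A‖ₑ ^ (-a) := by
      rw [mul_assoc]
      congr 1
      rw [hRdef, ENNReal.ofReal_div_of_pos (by norm_num), ← Real.enorm_eq_ofReal_abs,
        div_eq_mul_inv, ENNReal.mul_rpow_of_ne_top enorm_ne_top (by simp), mul_comm]
      simp [ENNReal.rpow_neg, ENNReal.inv_rpow]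
    _ ≤ _ := by
      gcongr
      rw [ENNReal.coe_add, ENNReal.coe_mul, ENNReal.coe_rpow_of_ne_zero (by norm_num)]
      push_cast
      exact le_self_add

/-! ### Integrals over a frequency variable -/

theorem one_le_bracket (x : ℝ) : 1 ≤ bracket x :=
  Real.one_le_sqrt.2 (by nlinarith [sq_nonneg x])

theorem bracket_pos (x : ℝ) : 0 < bracket x := one_pos.trans_le (one_le_bracket x)

theorem abs_le_bracket (x : ℝ) : |x| ≤ bracket x :=
  Real.abs_le_sqrt (by linarith)

theorem bracket_le (x : ℝ) : bracket x ≤ 1 + |x| :=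
  Real.sqrt_le_iff.2 ⟨by positivity, by nlinarith [abs_nonneg x, sq_abs x]⟩

theorem continuous_bracket : Continuous bracket := by
  unfold bracket; fun_prop

/-- The factorisation `y² - m² = (y - m)(y + m)` trades a quadratic singularity for two linear ones
of twice the order; if `M < 0`, both can be placed at the origin. -/
theorem exists_enorm_sq_sub_rpow_le (M : ℝ) {a : ℝ} (ha : 0 ≤ a) :
    ∃ m : ℝ, ∀ y : ℝ, ‖y ^ 2 - M‖ₑ ^ (-a) ≤ ‖y - m‖ₑ ^ (-(2 * a)) + ‖y + m‖ₑ ^ (-(2 * a)) := by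
  have hsq : ∀ x z : ℝ, x ^ 2 ≤ |z| → ‖z‖ₑ ^ (-a) ≤ ‖x‖ₑ ^ (-(2 * a)) := by
    intro x z h
    refine (enorm_rpow_neg_le ha h).trans (le_of_eq ?_)
    rw [← sq_abs, ENNReal.ofReal_pow (abs_nonneg x), ← Real.enorm_eq_ofReal_abs,
      ← ENNReal.rpow_natCast, ← ENNReal.rpow_mul]
    congr 1
    push_cast
    ring
  rcases le_total 0 M with hM | hM
  · refine ⟨√M, fun y => ?_⟩
    have h : y ^ 2 - M = (y - √M) * (y + √M) := by
      nlinarith [Real.sq_sqrt hM]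
    have habs : |y ^ 2 - M| = |y - √M| * |y + √M| := by rw [h, abs_mul]
    rcases le_total |y - √M| |y + √M| with h' | h'
    · refine le_add_right (hsq _ _ ?_)
      rw [habs, ← sq_abs]
      nlinarith [abs_nonneg (y - √M)]
    · refine le_add_left (hsq _ _ ?_)
      rw [habs, ← sq_abs (y + √M)]
      nlinarith [abs_nonneg (y + √M)]
  · refine ⟨0, fun y => le_add_right (hsq _ _ ?_)⟩
    rw [abs_of_nonneg (by nlinarith [sq_nonneg y])]
    nlinarith

theorem exists_lintegral_ball_enorm_sq_sub_rpow_le {a : ℝ} (ha0 : 0 ≤ a) (ha : a < 1 / 2) :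
    ∃ C : ℝ≥0, ∀ c M R : ℝ, 0 < R → ∫⁻ y in Metric.closedBall c R, ‖y ^ 2 - M‖ₑ ^ (-a) ≤
      C * ENNReal.ofReal R ^ (1 - 2 * a) := by
  obtain ⟨C, hC⟩ := exists_lintegral_ball_enorm_sub_rpow_le (θ := 2 * a) (by linarith)
    (by linarith)
  refine ⟨2 * C, fun c M R hR => ?_⟩
  obtain ⟨m, hm⟩ := exists_enorm_sq_sub_rpow_le M ha0
  refine (lintegral_mono hm).trans ?_
  rw [lintegral_add_left (by fun_prop)]
  have h2 := hC c (-m) R hR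
  simp only [sub_neg_eq_add] at h2
  refine (add_le_add (hC c m R hR) h2).trans (le_of_eq ?_)
  push_cast
  ring

theorem lintegral_abs_mul_comp_sq_sub_le {g : ℝ → ℝ≥0∞} (hg : Measurable g) (M : ℝ) :
    ∫⁻ y, ‖y‖ₑ * g (y ^ 2 - M) ≤ 2 * ∫⁻ v, g v := by
  have hmeas : Measurable fun y : ℝ => ‖y‖ₑ * g (y ^ 2 - M) := by fun_prop
  rw [lintegral_eq_two_mul_of_even hmeas (fun x => by simp)]
  refine mul_le_mul_right ?_ _
  have hinj : Set.InjOn (fun y : ℝ => y ^ 2 - M) (Set.Ioi 0) := by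
    intro x hx y hy h
    have h2 : x ^ 2 = y ^ 2 := by simpa using h
    exact (pow_left_inj₀ (le_of_lt hx) (le_of_lt hy) two_ne_zero).1 h2
  have hd : ∀ x ∈ Set.Ioi (0 : ℝ),
      HasDerivWithinAt (fun y : ℝ => y ^ 2 - M) (2 * x) (Set.Ioi 0) x := fun x _ => by
    simpa using (((hasDerivAt_id x).pow 2).sub_const M).hasDerivWithinAt
  have := lintegral_image_eq_lintegral_abs_deriv_mul measurableSet_Ioi hd hinj g
  calc ∫⁻ y in Set.Ioi 0, ‖y‖ₑ * g (y ^ 2 - M)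
      ≤ ∫⁻ y in Set.Ioi 0, ENNReal.ofReal |2 * y| * g (y ^ 2 - M) := by
        refine lintegral_mono fun y => ?_
        rw [Real.enorm_eq_ofReal_abs]
        refine mul_le_mul_left (ENNReal.ofReal_le_ofReal ?_) _
        rw [abs_mul]
        simp only [Nat.abs_ofNat]
        linarith [abs_nonneg y]
    _ ≤ ∫⁻ v, g v := by rw [← this]; exact setLIntegral_le_lintegral _ _

theorem lintegral_comp_mul_add (g : ℝ → ℝ≥0∞) {c : ℝ} (hc : c ≠ 0) (d : ℝ) :
    ENNReal.ofReal |c| * ∫⁻ y, g (c * y + d) = ∫⁻ v, g v := by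
  have hinj : Set.InjOn (fun y : ℝ => c * y + d) Set.univ := by
    intro x _ y _ h
    simpa [hc] using h
  have hd : ∀ x ∈ (Set.univ : Set ℝ),
      HasDerivWithinAt (fun y : ℝ => c * y + d) c Set.univ x := fun x _ => by
    simpa using ((hasDerivAt_id x).const_mul c).add_const d
  have h := lintegral_image_eq_lintegral_abs_deriv_mul MeasurableSet.univ hd hinj g
  have himg : (fun y : ℝ => c * y + d) '' Set.univ = Set.univ := by
    rw [Set.image_univ, Set.range_eq_univ]
    exact fun v => ⟨(v - d) / c, by field_simp; ring⟩
  rw [himg] at h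
  simp only [Measure.restrict_univ] at h
  rw [h, lintegral_const_mul' _ _ ENNReal.ofReal_ne_top]

/-- The integral behind the Cauchy-Schwarz argument in which one of the two Schrödinger frequencies
is fixed. The region is that of frequency difference at most `1`, together with that where the fixed
modulation `s` dominates. The condition `a < 1/2` makes `|y² - M|^{-a}` locally integrable,
uniformly in `M`. -/
theorem exists_lintegral_bracket_sub_mul_enorm_rpow_le {a : ℝ} (ha0 : 0 ≤ a) (ha : a < 1 / 2) :
    ∃ C : ℝ≥0, ∀ Y s : ℝ, ∫⁻ y, {y : ℝ | |Y - y| ≤ 1 ∨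
      |s - Y ^ 2 + y ^ 2| ≤ 2 * bracket s}.indicator
        (fun y => ENNReal.ofReal (bracket (Y - y)) * ‖s - Y ^ 2 + y ^ 2‖ₑ ^ (-a)) y ≤
      C * ENNReal.ofReal (bracket s) ^ (1 - a) := by
  obtain ⟨C, hC⟩ := exists_lintegral_ball_enorm_sq_sub_rpow_le ha0 ha
  refine ⟨2 * C + 8 * ((2 / (1 - a)).toNNReal * 2) + 4 * C, fun Y s => ?_⟩
  set S := bracket s with hS
  have hS1 : 1 ≤ S := one_le_bracket s
  have hsS : |s| ≤ S := abs_le_bracket s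
  set M := Y ^ 2 - s with hM
  have hsub : ∀ y : ℝ, s - Y ^ 2 + y ^ 2 = y ^ 2 - M := fun y => by rw [hM]; ring
  set r := √S with hr
  have hr1 : 1 ≤ r := Real.one_le_sqrt.2 hS1
  have hrS : r ^ 2 = S := Real.sq_sqrt (by linarith)
  set G : ℝ → ℝ≥0∞ := (Metric.closedBall (0 : ℝ) (2 * S)).indicator fun v => ‖v‖ₑ ^ (-a) with hG
  have hball : ∀ c R : ℝ, MeasurableSet (Metric.closedBall c R) :=
    fun c R => Metric.isClosed_closedBall.measurableSet
  have mG : Measurable G := (measurable_enorm_rpow _).indicator (hball _ _)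
  have mq : Measurable fun y : ℝ => ‖y ^ 2 - M‖ₑ ^ (-a) :=
    (measurable_enorm_rpow _).comp (by fun_prop)
  have key : ∀ y, {y : ℝ | |Y - y| ≤ 1 ∨ |s - Y ^ 2 + y ^ 2| ≤ 2 * S}.indicator
      (fun y => ENNReal.ofReal (bracket (Y - y)) * ‖s - Y ^ 2 + y ^ 2‖ₑ ^ (-a)) y ≤
      2 * (Metric.closedBall Y 1).indicator (fun y => ‖y ^ 2 - M‖ₑ ^ (-a)) y +
      4 * (‖y‖ₑ * G (y ^ 2 - M)) +
      4 * (ENNReal.ofReal r *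
        (Metric.closedBall 0 r).indicator (fun y => ‖y ^ 2 - M‖ₑ ^ (-a)) y) := by
    intro y
    by_cases hy : y ∈ {y : ℝ | |Y - y| ≤ 1 ∨ |s - Y ^ 2 + y ^ 2| ≤ 2 * S}
    swap
    · rw [Set.indicator_of_notMem hy]; exact zero_le
    rw [Set.indicator_of_mem hy, hsub]
    have hb := bracket_le (Y - y)
    by_cases h1 : |Y - y| ≤ 1
    · refine le_add_right (le_add_right ?_)
      rw [Set.indicator_of_mem (by rwa [Metric.mem_closedBall, dist_comm, Real.dist_eq])]
      gcongr
      rw [show (2 : ℝ≥0∞) = ENNReal.ofReal 2 by simp]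
      exact ENNReal.ofReal_le_ofReal (by linarith)
    have h2 : |y ^ 2 - M| ≤ 2 * S := by
      rcases hy with h | h
      · exact absurd h h1
      · rwa [hsub] at h
    have h3 : |y ^ 2 - Y ^ 2| ≤ 3 * S := by
      have : y ^ 2 - Y ^ 2 = (y ^ 2 - M) - s := by rw [hM]; ring
      rw [this]
      exact (abs_sub _ _).trans (by linarith)
    have h4 := abs_sub Y y
    rw [abs_le] at h3
    rcases le_total |y| r with h5 | h5
    · refine le_add_left ?_
      rw [Set.indicator_of_mem (by simpa using h5), ← mul_assoc]
      gcongr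
      rw [show (4 : ℝ≥0∞) = ENNReal.ofReal 4 by simp, ← ENNReal.ofReal_mul (by norm_num)]
      refine ENNReal.ofReal_le_ofReal ?_
      have hY : |Y| ≤ 2 * r := abs_le_of_sq_le_sq (by
        rw [← sq_abs y] at h3; nlinarith [abs_nonneg y]) (by linarith)
      linarith
    · refine le_add_right (le_add_left ?_)
      rw [hG, Set.indicator_of_mem (by simpa using h2), ← mul_assoc]
      gcongr
      rw [show (4 : ℝ≥0∞) = ENNReal.ofReal 4 by simp, Real.enorm_eq_ofReal_abs,
        ← ENNReal.ofReal_mul (by norm_num)]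
      refine ENNReal.ofReal_le_ofReal ?_
      have hY : |Y| ≤ 2 * |y| := abs_le_of_sq_le_sq (by
        rw [← sq_abs y] at h3; nlinarith [abs_nonneg y]) (by positivity)
      linarith
  have hS0 : ENNReal.ofReal S ≠ 0 := by simpa using by linarith
  have hSr : ENNReal.ofReal r = ENNReal.ofReal S ^ (1 / 2 : ℝ) := by
    rw [hr, Real.sqrt_eq_rpow, ENNReal.ofReal_rpow_of_pos (by linarith)]
  have e1 : (1 : ℝ≥0∞) ≤ ENNReal.ofReal S ^ (1 - a) :=
    ENNReal.one_le_rpow (by simpa using hS1) (by linarith)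
  calc _ ≤ ∫⁻ y, (2 * (Metric.closedBall Y 1).indicator (fun y => ‖y ^ 2 - M‖ₑ ^ (-a)) y +
      4 * (‖y‖ₑ * G (y ^ 2 - M)) +
      4 * (ENNReal.ofReal r *
        (Metric.closedBall 0 r).indicator (fun y => ‖y ^ 2 - M‖ₑ ^ (-a)) y)) := lintegral_mono key
    _ = 2 * (∫⁻ y in Metric.closedBall Y 1, ‖y ^ 2 - M‖ₑ ^ (-a)) +
        4 * (∫⁻ y, ‖y‖ₑ * G (y ^ 2 - M)) +
        4 * (ENNReal.ofReal r * ∫⁻ y in Metric.closedBall 0 r, ‖y ^ 2 - M‖ₑ ^ (-a)) := by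
      have i1 := mq.indicator (hball Y 1)
      have i2 := mq.indicator (hball 0 r)
      rw [lintegral_add_right _ (by fun_prop), lintegral_add_right _ (by fun_prop),
        lintegral_const_mul _ i1, lintegral_const_mul _ (by fun_prop),
        lintegral_const_mul _ (by fun_prop), lintegral_const_mul _ i2,
        lintegral_indicator (hball _ _), lintegral_indicator (hball _ _)]
    _ ≤ 2 * (C * ENNReal.ofReal S ^ (1 - a)) +
        4 * (2 * (ENNReal.ofReal (2 / (1 - a)) * (2 * ENNReal.ofReal S ^ (1 - a)))) +
        4 * (C * ENNReal.ofReal S ^ (1 - a)) := by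
      refine add_le_add (add_le_add (mul_le_mul_right ?_ _) (mul_le_mul_right ?_ _))
        (mul_le_mul_right ?_ _)
      · refine (hC Y M 1 one_pos).trans ?_
        gcongr
        simpa using e1
      · refine (lintegral_abs_mul_comp_sq_sub_le mG M).trans ?_
        gcongr
        rw [hG, lintegral_indicator (hball _ _)]
        refine (lintegral_ball_enorm_rpow (by linarith) (by linarith)).trans ?_
        gcongr
        rw [ENNReal.ofReal_mul (by norm_num), ENNReal.mul_rpow_of_nonneg _ _ (by linarith)]
        gcongr
        simp only [ENNReal.ofReal_ofNat]
        exact (ENNReal.rpow_le_rpow_of_exponent_le (by norm_num) (by linarith)).trans_eq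
          (ENNReal.rpow_one 2)
      · refine (mul_le_mul_right (hC 0 M r (by linarith)) _).trans (le_of_eq ?_)
        rw [mul_left_comm, hSr, ← ENNReal.rpow_mul, ← ENNReal.rpow_add _ _ hS0
          ENNReal.ofReal_ne_top]
        congr 2
        ring
    _ = _ := by
      push_cast
      rw [show ENNReal.ofReal (2 / (1 - a)) = ((2 / (1 - a)).toNNReal : ℝ≥0∞) from rfl]
      ring

/-- The integral behind the Cauchy-Schwarz argument in which the wave frequency `p` is fixed. -/
theorem exists_lintegral_enorm_linear_rpow_le {a : ℝ} (ha0 : 0 ≤ a) (ha : a < 1) :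
    ∃ C : ℝ≥0, ∀ p s : ℝ, 1 ≤ |p| → ∫⁻ y, {y : ℝ |
      |s + p * (2 * y + p)| ≤ 2 * bracket s}.indicator
        (fun y => ENNReal.ofReal (bracket p) * ‖s + p * (2 * y + p)‖ₑ ^ (-a)) y ≤
      C * ENNReal.ofReal (bracket s) ^ (1 - a) := by
  refine ⟨(2 / (1 - a)).toNNReal * 2, fun p s hp => ?_⟩
  set S := bracket s with hS
  have hS1 : 1 ≤ S := one_le_bracket s
  have hb := Metric.isClosed_closedBall (x := (0 : ℝ)) (ε := 2 * S) |>.measurableSet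
  have hp0 : p ≠ 0 := by rintro rfl; norm_num at hp
  calc _ ≤ ∫⁻ y, ENNReal.ofReal |2 * p| * (Metric.closedBall (0 : ℝ) (2 * S)).indicator
          (fun v => ‖v‖ₑ ^ (-a)) (2 * p * y + (s + p ^ 2)) := by
        refine lintegral_mono fun y => ?_
        have e : s + p * (2 * y + p) = 2 * p * y + (s + p ^ 2) := by ring
        simp only [Set.indicator, Set.mem_ofPred_eq, Metric.mem_closedBall, dist_zero_right,
          Real.norm_eq_abs, e]
        split_ifs
        · gcongr
          rw [abs_mul, Nat.abs_ofNat]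
          linarith [bracket_le p]
        · simp
    _ = ∫⁻ v in Metric.closedBall (0 : ℝ) (2 * S), ‖v‖ₑ ^ (-a) := by
        rw [lintegral_const_mul' _ _ ENNReal.ofReal_ne_top, lintegral_comp_mul_add (fun v =>
          (Metric.closedBall (0 : ℝ) (2 * S)).indicator (fun v => ‖v‖ₑ ^ (-a)) v)
          (by simpa using hp0), lintegral_indicator hb]
    _ ≤ _ := by
        refine (lintegral_ball_enorm_rpow ha (by linarith)).trans ?_
        rw [ENNReal.coe_mul, mul_assoc]
        refine mul_le_mul_right ?_ _
        rw [ENNReal.ofReal_mul (by norm_num), ENNReal.mul_rpow_of_nonneg _ _ (by linarith)]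
        refine mul_le_mul_left ?_ _
        simp only [ENNReal.ofReal_ofNat]
        exact (ENNReal.rpow_le_rpow_of_exponent_le (by norm_num) (by linarith)).trans_eq
          (ENNReal.rpow_one 2)

/-! ### Cauchy-Schwarz kernels by dominant modulation -/

/-- The bracket `⟨x⟩` as an extended nonnegative number. -/
def eBracket (x : ℝ) : ℝ≥0∞ := ENNReal.ofReal (bracket x)

@[fun_prop]
theorem measurable_eBracket : Measurable eBracket :=
  ENNReal.measurable_ofReal.comp continuous_bracket.measurable

theorem eBracket_ne_top (x : ℝ) : eBracket x ≠ ∞ := ENNReal.ofReal_ne_top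

theorem eBracket_ne_zero (x : ℝ) : eBracket x ≠ 0 := by
  simpa [eBracket] using bracket_pos x

theorem one_le_eBracket (x : ℝ) : 1 ≤ eBracket x := by
  simpa [eBracket] using one_le_bracket x

theorem eBracket_neg (x : ℝ) : eBracket (-x) = eBracket x := by simp [eBracket, bracket]

theorem eBracket_rpow_le (x : ℝ) {θ : ℝ} (hθ : 0 ≤ θ) : eBracket x ^ (-θ) ≤ ‖x‖ₑ ^ (-θ) := by
  rw [ENNReal.rpow_neg, ENNReal.rpow_neg, ENNReal.inv_le_inv, Real.enorm_eq_ofReal_abs]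
  exact ENNReal.rpow_le_rpow (ENNReal.ofReal_le_ofReal (abs_le_bracket x)) hθ

theorem exists_lintegral_eBracket_conv_le {α β : ℝ} (hα0 : 0 ≤ α) (hα : α < 1) (hβ0 : 0 ≤ β)
    (hβ : β < 1) (hαβ : 1 < α + β) :
    ∃ C : ℝ≥0, ∀ u v : ℝ, ∫⁻ t, eBracket (t + u) ^ (-α) * eBracket (t + v) ^ (-β) ≤
      C * ‖v - u‖ₑ ^ (-(α + β - 1)) := by
  obtain ⟨C, hC⟩ := exists_lintegral_enorm_rpow_conv_le hα0 hα hβ0 hβ hαβ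
  refine ⟨C, fun u v => ?_⟩
  calc ∫⁻ t, eBracket (t + u) ^ (-α) * eBracket (t + v) ^ (-β)
      ≤ ∫⁻ t, ‖t + u‖ₑ ^ (-α) * ‖t + u - (u - v)‖ₑ ^ (-β) := by
        refine lintegral_mono fun t => ?_
        rw [show t + u - (u - v) = t + v by ring]
        exact mul_le_mul' (eBracket_rpow_le _ hα0) (eBracket_rpow_le _ hβ0)
    _ = ∫⁻ t, ‖t‖ₑ ^ (-α) * ‖t - (u - v)‖ₑ ^ (-β) :=
        lintegral_add_right_eq_self (fun t => ‖t‖ₑ ^ (-α) * ‖t - (u - v)‖ₑ ^ (-β)) u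
    _ ≤ C * ‖v - u‖ₑ ^ (-(α + β - 1)) := by
        rw [← enorm_neg (v - u), neg_sub]; exact hC _

/-- The wave modulation `τ + εξ`. -/
def modW (ε : ℝ) (P : ℝ × ℝ) : ℝ := P.2 + ε * P.1

/-- The Schrödinger modulation `τ + ξ²`. -/
def modS (Q : ℝ × ℝ) : ℝ := Q.2 + Q.1 ^ 2

@[fun_prop]
theorem measurable_modW (ε : ℝ) : Measurable (modW ε) := by unfold modW; fun_prop

@[fun_prop]
theorem measurable_modS : Measurable modS := by unfold modS; fun_prop

/-- The square of the multiplier of the trilinear form: `P` is the frequency of the wave, `Q` and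
`P + Q` are those of the two Schrödinger waves. -/
def triKernel (ε b b₁ c : ℝ) (P Q : ℝ × ℝ) : ℝ≥0∞ :=
  eBracket P.1 * (eBracket (modW ε P) ^ (-(2 * b)) * eBracket (modS Q) ^ (-(2 * b₁)) *
    eBracket (modS (P + Q)) ^ (-(2 * c)))

@[fun_prop]
theorem measurable_triKernel (ε b b₁ c : ℝ) :
    Measurable (Function.uncurry (triKernel ε b b₁ c)) := by
  unfold triKernel Function.uncurry; fun_prop

/-- Low wave frequency, or the modulation of `P + Q` dominates. -/
def regionSum (ε : ℝ) : Set ((ℝ × ℝ) × (ℝ × ℝ)) :=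
  {z | |z.1.1| ≤ 1 ∨ |modW ε z.1 + modS z.2| ≤ 2 * bracket (modS (z.1 + z.2))}

/-- The modulation of `Q` dominates. -/
def regionRight (ε : ℝ) : Set ((ℝ × ℝ) × (ℝ × ℝ)) :=
  {z | |modS (z.1 + z.2) - modW ε z.1| ≤ 2 * bracket (modS z.2)}

/-- The wave frequency is not low, and the modulation of `P` dominates. -/
def regionLeft (ε : ℝ) : Set ((ℝ × ℝ) × (ℝ × ℝ)) :=
  {z | 1 ≤ |z.1.1| ∧ |modS (z.1 + z.2) - modS z.2| ≤ 2 * bracket (modW ε z.1)}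

theorem region_cover (ε : ℝ) (z : (ℝ × ℝ) × (ℝ × ℝ)) :
    z ∈ regionSum ε ∨ z ∈ regionRight ε ∨ z ∈ regionLeft ε := by
  simp only [regionSum, regionRight, regionLeft, Set.mem_ofPred_eq]
  have hb := abs_le_bracket
  have h1 := hb (modS (z.1 + z.2))
  have h2 := hb (modS z.2)
  have h3 := hb (modW ε z.1)
  have a1 := abs_add_le (modW ε z.1) (modS z.2)
  have a2 := abs_sub (modS (z.1 + z.2)) (modW ε z.1)
  have a3 := abs_sub (modS (z.1 + z.2)) (modS z.2)
  by_contra! h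
  obtain ⟨⟨h4, h5⟩, h6, h7⟩ := h
  have := h7 h4.le
  rcases le_total |modS (z.1 + z.2)| |modS z.2| with x | x <;>
  rcases le_total |modS (z.1 + z.2)| |modW ε z.1| with y | y <;>
  rcases le_total |modS z.2| |modW ε z.1| with w | w <;> linarith

theorem measurableSet_regionSum (ε : ℝ) : MeasurableSet (regionSum ε) := by
  have := continuous_bracket.measurable
  simp only [regionSum, Set.ofPred_or]
  refine MeasurableSet.union (measurableSet_le ?_ ?_) (measurableSet_le ?_ ?_) <;> fun_prop

theorem measurableSet_regionRight (ε : ℝ) : MeasurableSet (regionRight ε) := by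
  have := continuous_bracket.measurable
  refine (measurableSet_le ?_ ?_) <;> fun_prop

theorem measurableSet_regionLeft (ε : ℝ) : MeasurableSet (regionLeft ε) := by
  have := continuous_bracket.measurable
  simp only [regionLeft, Set.ofPred_and]
  refine MeasurableSet.inter (measurableSet_le ?_ ?_) (measurableSet_le ?_ ?_) <;> fun_prop

section

variable {b b₁ c : ℝ}

/-- Fubini's theorem for a kernel whose integral over the time frequency `t` is controlled by a
translate of `F` in `x`, when the power of `⟨s⟩` in front compensates the integral of `F`. -/
theorem lintegral_le_of_fiber_le {f : ℝ × ℝ → ℝ≥0∞} {F : ℝ → ℝ≥0∞} {s x₀ θ : ℝ} {C₁ C₂ : ℝ≥0}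
    (hf : ∀ x, ∫⁻ t, f (x, t) ≤ eBracket s ^ (-θ) * C₁ * F (x + x₀))
    (hF : ∫⁻ y, F y ≤ C₂ * eBracket s ^ θ) : ∫⁻ z, f z ≤ (C₁ * C₂ : ℝ≥0) := by
  rw [Measure.volume_eq_prod]
  calc _ ≤ ∫⁻ x, ∫⁻ t, f (x, t) := lintegral_prod_le _
    _ ≤ ∫⁻ x, eBracket s ^ (-θ) * C₁ * F (x + x₀) := lintegral_mono hf
    _ = eBracket s ^ (-θ) * C₁ * ∫⁻ y, F y := by
        rw [lintegral_const_mul' _ _ (ENNReal.mul_ne_top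
          (ENNReal.rpow_ne_top_of_ne_zero (eBracket_ne_zero _) (eBracket_ne_top _))
          ENNReal.coe_ne_top), lintegral_add_right_eq_self]
    _ ≤ eBracket s ^ (-θ) * C₁ * (C₂ * eBracket s ^ θ) := mul_le_mul_right hF _
    _ = C₁ * C₂ * (eBracket s ^ (-θ) * eBracket s ^ θ) := by ring
    _ = _ := by
        rw [← ENNReal.rpow_add _ _ (eBracket_ne_zero _) (eBracket_ne_top _), neg_add_cancel,
          ENNReal.rpow_zero]
        simp

theorem exists_lintegral_triKernel_regionSum_le (hb : 1 / 4 < b) (hb' : b < 1 / 2)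
    (hb₁ : 1 / 4 < b₁) (hb₁' : b₁ < 1 / 2) (hc : 1 / 4 < c)
    (hsum : b + b₁ + c = 1) :
    ∃ C : ℝ≥0, ∀ ε : ℝ, ∀ R : ℝ × ℝ, ∫⁻ Q, (regionSum ε).indicator
      (Function.uncurry (triKernel ε b b₁ c)) (R - Q, Q) ≤ C := by
  obtain ⟨C₁, hC₁⟩ := exists_lintegral_eBracket_conv_le (α := 2 * b) (β := 2 * b₁)
    (by linarith) (by linarith) (by linarith) (by linarith) (by linarith)
  obtain ⟨C₂, hC₂⟩ := exists_lintegral_bracket_sub_mul_enorm_rpow_le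
    (a := 2 * b + 2 * b₁ - 1) (by linarith) (by linarith)
  rw [show 1 - (2 * b + 2 * b₁ - 1) = 2 * c by linarith] at hC₂
  refine ⟨C₁ * C₂, fun ε R => ?_⟩
  set Y := R.1 - ε / 2 with hY
  refine lintegral_le_of_fiber_le (x₀ := -(ε / 2)) (fun x => ?_) (hC₂ Y (modS R))
  set k := eBracket (modS R) ^ (-(2 * c)) with hk
  set E := {y : ℝ | |Y - y| ≤ 1 ∨ |modS R - Y ^ 2 + y ^ 2| ≤ 2 * bracket (modS R)}
  have e1 : Y - (x + -(ε / 2)) = R.1 - x := by rw [hY]; ring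
  -- Completing the square absorbs the wave phase into a translation of `x` by `ε / 2`.
  have e2 : ∀ t : ℝ, modW ε (R - (x, t)) + modS (x, t) =
      modS R - Y ^ 2 + (x + -(ε / 2)) ^ 2 := by
    intro t
    simp only [modW, modS, hY, Prod.fst_sub, Prod.snd_sub]
    ring
  have hmem : ∀ t : ℝ, (R - (x, t), (x, t)) ∈ regionSum ε ↔ x + -(ε / 2) ∈ E := by
    intro t
    simp only [regionSum, Set.mem_ofPred_eq, e1, e2, sub_add_cancel, Prod.fst_sub, E]
  by_cases hx : x + -(ε / 2) ∈ E
  swap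
  · refine le_of_eq_of_le ?_ zero_le
    simp only [Set.indicator_of_notMem (fun h => hx ((hmem _).1 h)), lintegral_zero]
  calc _ ≤ ∫⁻ t, k * eBracket (R.1 - x) * (eBracket (t + -(R.2 + ε * (R.1 - x))) ^ (-(2 * b)) *
          eBracket (t + x ^ 2) ^ (-(2 * b₁))) := by
        refine lintegral_mono fun t => (Set.indicator_le_self _ _ _).trans (le_of_eq ?_)
        simp only [Function.uncurry, triKernel, sub_add_cancel, ← hk, Prod.fst_sub]
        rw [show modS (x, t) = t + x ^ 2 from rfl, show modW ε (R - (x, t)) =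
          -(t + -(R.2 + ε * (R.1 - x))) by simp [modW]; ring, eBracket_neg]
        ring
    _ ≤ k * eBracket (R.1 - x) * (C₁ * ‖x ^ 2 - -(R.2 + ε * (R.1 - x))‖ₑ ^
          (-(2 * b + 2 * b₁ - 1))) := by
        rw [lintegral_const_mul _ (by fun_prop)]
        exact mul_le_mul_right (hC₁ _ _) _
    _ = _ := by
        rw [Set.indicator_of_mem hx, e1, ← e2 0]
        rw [show x ^ 2 - -(R.2 + ε * (R.1 - x)) = modW ε (R - (x, 0)) + modS (x, 0) by
          simp [modW, modS]; ring]
        simp only [eBracket]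
        ring

theorem exists_lintegral_triKernel_regionRight_le (hb : 1 / 4 < b) (hb' : b < 1 / 2)
    (hb₁ : 1 / 4 < b₁) (hc : 1 / 4 < c) (hc' : c < 1 / 2)
    (hsum : b + b₁ + c = 1) :
    ∃ C : ℝ≥0, ∀ ε : ℝ, ∀ Q : ℝ × ℝ, ∫⁻ P, (regionRight ε).indicator
      (Function.uncurry (triKernel ε b b₁ c)) (P, Q) ≤ C := by
  obtain ⟨C₁, hC₁⟩ := exists_lintegral_eBracket_conv_le (α := 2 * b) (β := 2 * c)
    (by linarith) (by linarith) (by linarith) (by linarith) (by linarith)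
  obtain ⟨C₂, hC₂⟩ := exists_lintegral_bracket_sub_mul_enorm_rpow_le
    (a := 2 * b + 2 * c - 1) (by linarith) (by linarith)
  rw [show 1 - (2 * b + 2 * c - 1) = 2 * b₁ by linarith] at hC₂
  refine ⟨C₁ * C₂, fun ε Q => ?_⟩
  set Y := Q.1 - ε / 2 with hY
  refine lintegral_le_of_fiber_le (x₀ := Y) (fun x => ?_) (hC₂ Y (modS Q))
  set k := eBracket (modS Q) ^ (-(2 * b₁)) with hk
  set E := {y : ℝ | |Y - y| ≤ 1 ∨ |modS Q - Y ^ 2 + y ^ 2| ≤ 2 * bracket (modS Q)}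
  have e1 : Y - (x + Y) = -x := by ring
  have e2 : ∀ t : ℝ, modS ((x, t) + Q) - modW ε (x, t) = modS Q - Y ^ 2 + (x + Y) ^ 2 := by
    intro t
    simp only [modW, modS, hY, Prod.fst_add, Prod.snd_add]
    ring
  by_cases hx : x + Y ∈ E
  swap
  · refine le_of_eq_of_le ?_ zero_le
    have hnot : ∀ t : ℝ, ((x, t), Q) ∉ regionRight ε := fun t h => hx (Or.inr (by
      simpa only [regionRight, Set.mem_ofPred_eq, e2] using h))
    simp only [Set.indicator_of_notMem (hnot _), lintegral_zero]
  calc _ ≤ ∫⁻ t, k * eBracket x * (eBracket (t + ε * x) ^ (-(2 * b)) *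
          eBracket (t + (Q.2 + (x + Q.1) ^ 2)) ^ (-(2 * c))) := by
        refine lintegral_mono fun t => (Set.indicator_le_self _ _ _).trans (le_of_eq ?_)
        simp only [Function.uncurry, triKernel, ← hk]
        rw [show modW ε (x, t) = t + ε * x from rfl,
          show modS ((x, t) + Q) = t + (Q.2 + (x + Q.1) ^ 2) by simp [modS]; ring]
        ring
    _ ≤ k * eBracket x * (C₁ * ‖Q.2 + (x + Q.1) ^ 2 - ε * x‖ₑ ^ (-(2 * b + 2 * c - 1))) := by
        rw [lintegral_const_mul _ (by fun_prop)]
        exact mul_le_mul_right (hC₁ _ _) _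
    _ = _ := by
        rw [Set.indicator_of_mem hx, e1, ← e2 0]
        rw [show Q.2 + (x + Q.1) ^ 2 - ε * x = modS ((x, 0) + Q) - modW ε (x, 0) by
          simp [modW, modS], ← eBracket, eBracket_neg]
        ring

theorem exists_lintegral_triKernel_regionLeft_le (hb : 1 / 4 < b) (hb' : b < 1 / 2)
    (hb₁ : 1 / 4 < b₁) (hb₁' : b₁ < 1 / 2) (hc : 1 / 4 < c) (hc' : c < 1 / 2)
    (hsum : b + b₁ + c = 1) :
    ∃ C : ℝ≥0, ∀ ε : ℝ, ∀ P : ℝ × ℝ, ∫⁻ Q, (regionLeft ε).indicator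
      (Function.uncurry (triKernel ε b b₁ c)) (P, Q) ≤ C := by
  obtain ⟨C₁, hC₁⟩ := exists_lintegral_eBracket_conv_le (α := 2 * b₁) (β := 2 * c)
    (by linarith) (by linarith) (by linarith) (by linarith) (by linarith)
  obtain ⟨C₂, hC₂⟩ := exists_lintegral_enorm_linear_rpow_le
    (a := 2 * b₁ + 2 * c - 1) (by linarith) (by linarith)
  rw [show 1 - (2 * b₁ + 2 * c - 1) = 2 * b by linarith] at hC₂
  refine ⟨C₁ * C₂, fun ε P => ?_⟩
  by_cases hP : 1 ≤ |P.1|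
  swap
  · have hnot : ∀ Q, (P, Q) ∉ regionLeft ε := fun Q h => hP h.1
    simp only [Set.indicator_of_notMem (hnot _), lintegral_zero, zero_le]
  refine lintegral_le_of_fiber_le (x₀ := -(ε / 2)) (fun x => ?_) (hC₂ P.1 (modW ε P) hP)
  set k := eBracket (modW ε P) ^ (-(2 * b)) with hk
  set E := {y : ℝ | |modW ε P + P.1 * (2 * y + P.1)| ≤ 2 * bracket (modW ε P)}
  have e2 : ∀ t : ℝ, modS (P + (x, t)) - modS (x, t) =
      modW ε P + P.1 * (2 * (x + -(ε / 2)) + P.1) := by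
    intro t
    simp only [modW, modS, Prod.fst_add, Prod.snd_add]
    ring
  by_cases hx : x + -(ε / 2) ∈ E
  swap
  · refine le_of_eq_of_le ?_ zero_le
    have hnot : ∀ t : ℝ, (P, (x, t)) ∉ regionLeft ε := fun t h => hx (by
      simpa only [regionLeft, Set.mem_ofPred_eq, e2, E] using h.2)
    simp only [Set.indicator_of_notMem (hnot _), lintegral_zero]
  calc _ ≤ ∫⁻ t, k * eBracket P.1 * (eBracket (t + x ^ 2) ^ (-(2 * b₁)) *
          eBracket (t + (P.2 + (P.1 + x) ^ 2)) ^ (-(2 * c))) := by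
        refine lintegral_mono fun t => (Set.indicator_le_self _ _ _).trans (le_of_eq ?_)
        simp only [Function.uncurry, triKernel, ← hk]
        rw [show modS (x, t) = t + x ^ 2 from rfl,
          show modS (P + (x, t)) = t + (P.2 + (P.1 + x) ^ 2) by simp [modS]; ring]
        ring
    _ ≤ k * eBracket P.1 * (C₁ * ‖P.2 + (P.1 + x) ^ 2 - x ^ 2‖ₑ ^ (-(2 * b₁ + 2 * c - 1))) := by
        rw [lintegral_const_mul _ (by fun_prop)]
        exact mul_le_mul_right (hC₁ _ _) _
    _ = _ := by
        rw [Set.indicator_of_mem hx, ← e2 0]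
        rw [show P.2 + (P.1 + x) ^ 2 - x ^ 2 = modS (P + (x, 0)) - modS (x, 0) by
          simp [modS]]
        simp only [eBracket]
        ring

/-! ### The Cauchy-Schwarz argument -/

/-- The Cauchy-Schwarz inequality for a positive trilinear form, with the variable `x` held fixed.
All functions are replaced by their squares. -/
theorem lintegral_lintegral_sqrt_le {X Y : Type*} [MeasurableSpace X] [MeasurableSpace Y]
    {μ : Measure X} {ν : Measure Y} [SFinite ν] {k G : X → Y → ℝ≥0∞} {h : X → ℝ≥0∞}
    (hk : Measurable (Function.uncurry k)) (hG : Measurable (Function.uncurry G))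
    (hh : Measurable h) {A : ℝ≥0∞} (hA : ∀ x, ∫⁻ y, k x y ∂ν ≤ A) :
    ∫⁻ x, ∫⁻ y, (k x y * G x y * h x) ^ (1 / 2 : ℝ) ∂ν ∂μ ≤
      A ^ (1 / 2 : ℝ) * (∫⁻ x, ∫⁻ y, G x y ∂ν ∂μ) ^ (1 / 2 : ℝ) * (∫⁻ x, h x ∂μ) ^ (1 / 2 : ℝ) := by
  have hG' : Measurable fun x => ∫⁻ y, G x y ∂ν := hG.lintegral_prod_right'
  have hhalf : (1 / 2 : ℝ) + 1 / 2 = 1 := by norm_num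
  have h0 : (0 : ℝ) ≤ 1 / 2 := by norm_num
  calc _ ≤ ∫⁻ x, A ^ (1 / 2 : ℝ) * ((∫⁻ y, G x y ∂ν) ^ (1 / 2 : ℝ) * h x ^ (1 / 2 : ℝ)) ∂μ := by
        refine lintegral_mono fun x => ?_
        have hkx : Measurable (k x) := hk.comp measurable_prodMk_left
        have hGx : Measurable (G x) := hG.comp measurable_prodMk_left
        calc _ = (∫⁻ y, k x y ^ (1 / 2 : ℝ) * G x y ^ (1 / 2 : ℝ) ∂ν) * h x ^ (1 / 2 : ℝ) := by
              rw [← lintegral_mul_const _ (by fun_prop)]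
              simp only [ENNReal.mul_rpow_of_nonneg _ _ h0]
          _ ≤ ((∫⁻ y, k x y ∂ν) ^ (1 / 2 : ℝ) * (∫⁻ y, G x y ∂ν) ^ (1 / 2 : ℝ)) *
                h x ^ (1 / 2 : ℝ) := mul_le_mul_left (ENNReal.lintegral_mul_norm_pow_le
                  hkx.aemeasurable hGx.aemeasurable h0 h0 hhalf) _
          _ ≤ _ := by
              rw [← mul_assoc]
              exact mul_le_mul_left (mul_le_mul_left (ENNReal.rpow_le_rpow (hA x) h0) _) _
    _ = A ^ (1 / 2 : ℝ) * ∫⁻ x, (∫⁻ y, G x y ∂ν) ^ (1 / 2 : ℝ) * h x ^ (1 / 2 : ℝ) ∂μ :=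
        lintegral_const_mul _ (by fun_prop)
    _ ≤ _ := by
        rw [mul_assoc]
        exact mul_le_mul_right (ENNReal.lintegral_mul_norm_pow_le hG'.aemeasurable
          hh.aemeasurable h0 h0 hhalf) _

theorem lintegral_lintegral_translate {f g : ℝ × ℝ → ℝ≥0∞} (hf : Measurable f)
    (hg : Measurable g) (e : ℝ) :
    ∫⁻ Q, ∫⁻ P, g Q * f (P + e • Q) = (∫⁻ Q, g Q) * ∫⁻ P, f P := by
  have : ∀ Q : ℝ × ℝ, ∫⁻ P, g Q * f (P + e • Q) = g Q * ∫⁻ P, f P := fun Q => by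
    rw [lintegral_const_mul _ (by fun_prop), lintegral_add_right_eq_self]
  simp only [this]
  exact lintegral_mul_const _ hg

/-- The trilinear estimate, for the squares of the three functions. -/
theorem exists_trilinear_sqrt_le (hb : 1 / 4 < b) (hb' : b < 1 / 2)
    (hb₁ : 1 / 4 < b₁) (hb₁' : b₁ < 1 / 2) (hc : 1 / 4 < c) (hc' : c < 1 / 2)
    (hsum : b + b₁ + c = 1) :
    ∃ C : ℝ≥0, ∀ ε : ℝ, ∀ f g h : ℝ × ℝ → ℝ≥0∞, Measurable f → Measurable g →
      Measurable h → ∫⁻ Q, ∫⁻ P,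
        (triKernel ε b b₁ c P Q * (f P * g Q * h (P + Q))) ^ (1 / 2 : ℝ) ≤
      C * ((∫⁻ P, f P) ^ (1 / 2 : ℝ) * (∫⁻ Q, g Q) ^ (1 / 2 : ℝ) *
        (∫⁻ R, h R) ^ (1 / 2 : ℝ)) := by
  obtain ⟨C₁, hC₁⟩ := exists_lintegral_triKernel_regionSum_le hb hb' hb₁ hb₁' hc hsum
  obtain ⟨C₂, hC₂⟩ := exists_lintegral_triKernel_regionRight_le hb hb' hb₁ hc hc' hsum
  obtain ⟨C₃, hC₃⟩ := exists_lintegral_triKernel_regionLeft_le hb hb' hb₁ hb₁' hc hc' hsum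
  refine ⟨C₁ ^ (1 / 2 : ℝ) + C₂ ^ (1 / 2 : ℝ) + C₃ ^ (1 / 2 : ℝ), fun ε f g h hf hg hh => ?_⟩
  have h0 : (0 : ℝ) ≤ 1 / 2 := by norm_num
  set K := Function.uncurry (triKernel ε b b₁ c) with hK
  have mK : Measurable K := measurable_triKernel ε b b₁ c
  set K₁ := (regionSum ε).indicator K with hK₁
  set K₂ := (regionRight ε).indicator K with hK₂
  set K₃ := (regionLeft ε).indicator K with hK₃
  have m₁ : Measurable K₁ := mK.indicator (measurableSet_regionSum ε)
  have m₂ : Measurable K₂ := mK.indicator (measurableSet_regionRight ε)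
  have m₃ : Measurable K₃ := mK.indicator (measurableSet_regionLeft ε)
  set Φ : (ℝ × ℝ) → (ℝ × ℝ) → ℝ≥0∞ := fun P Q => f P * g Q * h (P + Q) with hΦ
  have mΦ : Measurable (Function.uncurry Φ) := by unfold Function.uncurry; fun_prop
  have cover : ∀ P Q, (triKernel ε b b₁ c P Q * Φ P Q) ^ (1 / 2 : ℝ) ≤
      (K₁ (P, Q) * Φ P Q) ^ (1 / 2 : ℝ) + (K₂ (P, Q) * Φ P Q) ^ (1 / 2 : ℝ) +
      (K₃ (P, Q) * Φ P Q) ^ (1 / 2 : ℝ) := by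
    intro P Q
    rcases region_cover ε (P, Q) with hz | hz | hz
    · refine le_add_right (le_add_right (le_of_eq ?_))
      rw [hK₁, Set.indicator_of_mem hz]; rfl
    · refine le_add_right (le_add_left (le_of_eq ?_))
      rw [hK₂, Set.indicator_of_mem hz]; rfl
    · refine le_add_left (le_of_eq ?_)
      rw [hK₃, Set.indicator_of_mem hz]; rfl
  have mm : ∀ k : (ℝ × ℝ) × (ℝ × ℝ) → ℝ≥0∞, Measurable k → Measurable
      fun z : (ℝ × ℝ) × (ℝ × ℝ) => (k (z.2, z.1) * Φ z.2 z.1) ^ (1 / 2 : ℝ) := by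
    intro k hk
    have h1 : Measurable fun z : (ℝ × ℝ) × (ℝ × ℝ) => Φ z.2 z.1 := mΦ.comp measurable_swap
    have h2 : Measurable fun z : (ℝ × ℝ) × (ℝ × ℝ) => k (z.2, z.1) := hk.comp measurable_swap
    fun_prop
  have outer : ∀ k : (ℝ × ℝ) × (ℝ × ℝ) → ℝ≥0∞, Measurable k →
      Measurable fun Q => ∫⁻ P, (k (P, Q) * Φ P Q) ^ (1 / 2 : ℝ) :=
    fun k hk => (mm k hk).lintegral_prod_right'
  have inner : ∀ k : (ℝ × ℝ) × (ℝ × ℝ) → ℝ≥0∞, Measurable k → ∀ Q,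
      Measurable fun P => (k (P, Q) * Φ P Q) ^ (1 / 2 : ℝ) :=
    fun k hk Q => (mm k hk).comp (measurable_prodMk_left (x := Q))
  have t₁ : ∫⁻ Q, ∫⁻ P, (K₁ (P, Q) * Φ P Q) ^ (1 / 2 : ℝ) ≤
      C₁ ^ (1 / 2 : ℝ) * (∫⁻ Q, ∫⁻ P, g P * f (Q + (-1 : ℝ) • P)) ^ (1 / 2 : ℝ) *
        (∫⁻ R, h R) ^ (1 / 2 : ℝ) := by
    calc _ = ∫⁻ Q, ∫⁻ R, (K₁ (R - Q, Q) * (g Q * f (R + (-1 : ℝ) • Q)) * h R) ^ (1 / 2 : ℝ) := by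
          refine lintegral_congr fun Q => ?_
          rw [← lintegral_sub_right_eq_self _ Q]
          refine lintegral_congr fun R => ?_
          simp only [Φ, sub_add_cancel, neg_smul, one_smul, ← sub_eq_add_neg]
          congr 1; ring
      _ = ∫⁻ R, ∫⁻ Q, (K₁ (R - Q, Q) * (g Q * f (R + (-1 : ℝ) • Q)) * h R) ^ (1 / 2 : ℝ) := by
          refine lintegral_lintegral_swap (Measurable.aemeasurable ?_)
          unfold Function.uncurry; fun_prop
      _ ≤ _ := lintegral_lintegral_sqrt_le (k := fun R Q => K₁ (R - Q, Q))
          (G := fun R Q => g Q * f (R + (-1 : ℝ) • Q)) (by unfold Function.uncurry; fun_prop)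
          (by unfold Function.uncurry; fun_prop) hh (hC₁ ε)
  have t₂ : ∫⁻ Q, ∫⁻ P, (K₂ (P, Q) * Φ P Q) ^ (1 / 2 : ℝ) ≤
      C₂ ^ (1 / 2 : ℝ) * (∫⁻ Q, ∫⁻ P, f P * h (Q + (1 : ℝ) • P)) ^ (1 / 2 : ℝ) *
        (∫⁻ Q, g Q) ^ (1 / 2 : ℝ) := by
    calc _ = ∫⁻ Q, ∫⁻ P, (K₂ (P, Q) * (f P * h (Q + (1 : ℝ) • P)) * g Q) ^ (1 / 2 : ℝ) := by
          refine lintegral_congr fun Q => lintegral_congr fun P => ?_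
          simp only [Φ, one_smul, add_comm Q P]
          congr 1; ring
      _ ≤ _ := lintegral_lintegral_sqrt_le (k := fun Q P => K₂ (P, Q))
          (G := fun Q P => f P * h (Q + (1 : ℝ) • P)) (by unfold Function.uncurry; fun_prop)
          (by unfold Function.uncurry; fun_prop) hg (hC₂ ε)
  have t₃ : ∫⁻ Q, ∫⁻ P, (K₃ (P, Q) * Φ P Q) ^ (1 / 2 : ℝ) ≤
      C₃ ^ (1 / 2 : ℝ) * (∫⁻ P, ∫⁻ Q, g Q * h (P + (1 : ℝ) • Q)) ^ (1 / 2 : ℝ) *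
        (∫⁻ P, f P) ^ (1 / 2 : ℝ) := by
    calc _ = ∫⁻ P, ∫⁻ Q, (K₃ (P, Q) * (g Q * h (P + (1 : ℝ) • Q)) * f P) ^ (1 / 2 : ℝ) := by
          rw [lintegral_lintegral_swap (mm K₃ m₃).aemeasurable]
          refine lintegral_congr fun P => lintegral_congr fun Q => ?_
          simp only [Φ, one_smul]
          congr 1; ring
      _ ≤ _ := lintegral_lintegral_sqrt_le (k := fun P Q => K₃ (P, Q))
          (G := fun P Q => g Q * h (P + (1 : ℝ) • Q)) (by unfold Function.uncurry; fun_prop)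
          (by unfold Function.uncurry; fun_prop) hf (hC₃ ε)
  have sw : ∀ (u v : ℝ × ℝ → ℝ≥0∞) (e : ℝ), Measurable u → Measurable v →
      ∫⁻ R, ∫⁻ Q, v Q * u (R + e • Q) = (∫⁻ Q, v Q) * ∫⁻ P, u P := by
    intro u v e hu hv
    rw [← lintegral_lintegral_translate hu hv e]
    refine lintegral_lintegral_swap (Measurable.aemeasurable ?_)
    unfold Function.uncurry; fun_prop
  rw [sw f g _ hf hg] at t₁
  rw [sw h f _ hh hf] at t₂
  rw [sw h g _ hh hg] at t₃
  rw [ENNReal.mul_rpow_of_nonneg _ _ h0] at t₁ t₂ t₃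
  calc _ ≤ ∫⁻ Q, ∫⁻ P, ((K₁ (P, Q) * Φ P Q) ^ (1 / 2 : ℝ) + (K₂ (P, Q) * Φ P Q) ^ (1 / 2 : ℝ) +
          (K₃ (P, Q) * Φ P Q) ^ (1 / 2 : ℝ)) :=
        lintegral_mono fun Q => lintegral_mono fun P => cover P Q
    _ = (∫⁻ Q, ∫⁻ P, (K₁ (P, Q) * Φ P Q) ^ (1 / 2 : ℝ)) +
          (∫⁻ Q, ∫⁻ P, (K₂ (P, Q) * Φ P Q) ^ (1 / 2 : ℝ)) +
          ∫⁻ Q, ∫⁻ P, (K₃ (P, Q) * Φ P Q) ^ (1 / 2 : ℝ) := by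
        rw [← lintegral_add_right _ (outer K₂ m₂), ← lintegral_add_right _ (outer K₃ m₃)]
        refine lintegral_congr fun Q => ?_
        rw [lintegral_add_right _ (inner K₃ m₃ Q), lintegral_add_right _ (inner K₂ m₂ Q)]
    _ ≤ _ := by
        refine (add_le_add (add_le_add t₁ t₂) t₃).trans (le_of_eq ?_)
        rw [ENNReal.coe_add, ENNReal.coe_add, ENNReal.coe_rpow_of_nonneg _ h0,
          ENNReal.coe_rpow_of_nonneg _ h0, ENNReal.coe_rpow_of_nonneg _ h0]
        ring

end

/-! ### The trilinear estimate in weighted norms -/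

/-- The weighted `L²` norm `(∬ w |f|²)^{1/2}` of a nonnegative function. -/
def weightedNorm (w : ℝ × ℝ → ℝ) (f : ℝ × ℝ → ℝ≥0∞) : ℝ≥0∞ :=
  (∫⁻ p, ENNReal.ofReal (w p) * f p ^ 2) ^ (1 / 2 : ℝ)

/-- The weight of `X^S_{0,α}`. -/
def weightS (α : ℝ) (p : ℝ × ℝ) : ℝ := bracket (p.2 + |p.1| ^ 2) ^ (2 * α)

/-- The weight of `X^{W±}_{-1/2,α}`. -/
def weightW (ε α : ℝ) (p : ℝ × ℝ) : ℝ :=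
  bracket p.1 ^ (-1 : ℝ) * bracket (p.2 + ε * p.1) ^ (2 * α)

theorem ofReal_weightS (α : ℝ) (p : ℝ × ℝ) :
    ENNReal.ofReal (weightS α p) = eBracket (modS p) ^ (2 * α) := by
  rw [weightS, sq_abs, ← ENNReal.ofReal_rpow_of_pos (bracket_pos _)]
  rfl

theorem ofReal_weightW (ε α : ℝ) (p : ℝ × ℝ) :
    ENNReal.ofReal (weightW ε α p) = (eBracket p.1)⁻¹ * eBracket (modW ε p) ^ (2 * α) := by
  rw [weightW, ENNReal.ofReal_mul (Real.rpow_nonneg (bracket_pos _).le _),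
    ← ENNReal.ofReal_rpow_of_pos (bracket_pos _), ← ENNReal.ofReal_rpow_of_pos (bracket_pos _),
    ENNReal.rpow_neg_one]
  rfl

/-- Since `⟨·⟩ ≥ 1`, lowering the exponents strengthens the trilinear estimate, so their sum may be
taken to be `1`. -/
theorem exists_exponents_le {b b₁ c : ℝ} (hb : 1 / 4 < b) (hb₁ : 1 / 4 < b₁) (hc : 1 / 4 < c)
    (hsum : 1 ≤ b + b₁ + c) :
    ∃ b' b₁' c' : ℝ, 1 / 4 < b' ∧ 1 / 4 < b₁' ∧ 1 / 4 < c' ∧ b' ≤ b ∧ b₁' ≤ b₁ ∧ c' ≤ c ∧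
      b' + b₁' + c' = 1 := by
  have hs : 0 < b + b₁ + c - 3 / 4 := by linarith
  set t := 1 / 4 / (b + b₁ + c - 3 / 4) with ht
  have ht0 : 0 < t := by positivity
  have ht1 : t ≤ 1 := by rw [ht, div_le_one hs]; linarith
  have hts : t * (b + b₁ + c - 3 / 4) = 1 / 4 := div_mul_cancel₀ _ hs.ne'
  refine ⟨1 / 4 + t * (b - 1 / 4), 1 / 4 + t * (b₁ - 1 / 4), 1 / 4 + t * (c - 1 / 4), ?_, ?_, ?_,
    ?_, ?_, ?_, by linarith⟩ <;> nlinarith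

/-- The trilinear estimate on the Fourier side. Duality in the last factor gives the bound for
`n u`, duality in the first factor that for `∂ₓ(u₁ ū₂)`. -/
theorem exists_trilinear_le {b b₁ c : ℝ} (hb : 1 / 4 < b) (hb' : b < 1 / 2)
    (hb₁ : 1 / 4 < b₁) (hb₁' : b₁ < 1 / 2) (hc : 1 / 4 < c) (hc' : c < 1 / 2)
    (hsum : 1 ≤ b + b₁ + c) :
    ∃ C : ℝ≥0, ∀ ε : ℝ, ∀ f g h : ℝ × ℝ → ℝ≥0∞, Measurable f → Measurable g →
      Measurable h → ∫⁻ Q, ∫⁻ P, f P * g Q * h (P + Q) ≤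
        C * (weightedNorm (weightW ε b) f * weightedNorm (weightS b₁) g *
          weightedNorm (weightS c) h) := by
  obtain ⟨d, d₁, e, hd, hd₁, he, hdb, hdb₁, hec, hs⟩ := exists_exponents_le hb hb₁ hc hsum
  obtain ⟨C, hC⟩ := exists_trilinear_sqrt_le hd (by linarith) hd₁ (by linarith) he (by linarith) hs
  refine ⟨C, fun ε f g h hf hg hh => ?_⟩
  have h0 : (0 : ℝ) ≤ 1 / 2 := by norm_num
  have cancel : ∀ x θ : ℝ, eBracket x ^ (-θ) * eBracket x ^ θ = 1 := fun x θ => by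
    rw [← ENNReal.rpow_add _ _ (eBracket_ne_zero _) (eBracket_ne_top _), neg_add_cancel,
      ENNReal.rpow_zero]
  have mono : ∀ x θ θ' : ℝ, θ ≤ θ' → eBracket x ^ (2 * θ) ≤ eBracket x ^ (2 * θ') :=
    fun x θ θ' hθ => ENNReal.rpow_le_rpow_of_exponent_le (one_le_eBracket x) (by linarith)
  set F : ℝ × ℝ → ℝ≥0∞ := fun P => (eBracket P.1)⁻¹ * eBracket (modW ε P) ^ (2 * d) * f P ^ 2
  set G : ℝ × ℝ → ℝ≥0∞ := fun Q => eBracket (modS Q) ^ (2 * d₁) * g Q ^ 2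
  set H : ℝ × ℝ → ℝ≥0∞ := fun R => eBracket (modS R) ^ (2 * e) * h R ^ 2
  have key := hC ε F G H (by fun_prop) (by fun_prop) (by fun_prop)
  have pt : ∀ P Q, (triKernel ε d d₁ e P Q * (F P * G Q * H (P + Q))) ^ (1 / 2 : ℝ) =
      f P * g Q * h (P + Q) := by
    intro P Q
    have : triKernel ε d d₁ e P Q * (F P * G Q * H (P + Q)) = (f P * g Q * h (P + Q)) ^ 2 := by
      simp only [triKernel, F, G, H]
      calc _ = (eBracket P.1 * (eBracket P.1)⁻¹) *
            (eBracket (modW ε P) ^ (-(2 * d)) * eBracket (modW ε P) ^ (2 * d)) *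
            (eBracket (modS Q) ^ (-(2 * d₁)) * eBracket (modS Q) ^ (2 * d₁)) *
            (eBracket (modS (P + Q)) ^ (-(2 * e)) * eBracket (modS (P + Q)) ^ (2 * e)) *
            (f P * g Q * h (P + Q)) ^ 2 := by ring
        _ = _ := by
          rw [cancel, cancel, cancel, ENNReal.mul_inv_cancel (eBracket_ne_zero _)
            (eBracket_ne_top _)]
          simp only [one_mul]
    rw [this, ← ENNReal.rpow_natCast, ← ENNReal.rpow_mul]
    norm_num
  simp only [pt] at key
  refine key.trans (mul_le_mul_right (mul_le_mul' (mul_le_mul' ?_ ?_) ?_) _) <;>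
    refine ENNReal.rpow_le_rpow (lintegral_mono fun p => ?_) h0
  · rw [ofReal_weightW]
    exact mul_le_mul_left (mul_le_mul_right (mono _ _ _ hdb) _) _
  · rw [ofReal_weightS]
    exact mul_le_mul_left (mono _ _ _ hdb₁) _
  · rw [ofReal_weightS]
    exact mul_le_mul_left (mono _ _ _ hec) _

/-! ### The Fourier transform on Schwartz space -/

theorem _root_.MeasureTheory.Integrable.mul_schwartz {f : ℝ × ℝ → ℂ} (hf : Integrable f)
    (φ : 𝓢(ℝ × ℝ, ℂ)) : Integrable fun p => f p * φ p :=
  hf.mul_bdd (c := SchwartzMap.seminorm ℝ 0 0 φ) φ.continuous.aestronglyMeasurable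
    (Eventually.of_forall fun p => φ.norm_le_seminorm ℝ p)

/-- The character `e^{-i p·q}` on `ℝ × ℝ`. -/
def phase (p q : ℝ × ℝ) : ℂ := Complex.exp (-Complex.I * ((p.1 * q.1 + p.2 * q.2 : ℝ) : ℂ))

theorem continuous_phase : Continuous (Function.uncurry phase) := by
  unfold phase Function.uncurry; fun_prop

theorem norm_phase (p q : ℝ × ℝ) : ‖phase p q‖ = 1 := by
  rw [phase, Complex.norm_exp]; simp

theorem phase_comm (p q : ℝ × ℝ) : phase p q = phase q p := by
  simp only [phase, mul_comm]

theorem phase_sub_right (p q r : ℝ × ℝ) : phase p (q - r) = phase p q * phase p (-r) := by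
  simp only [phase, ← Complex.exp_add]
  congr 1; push_cast; simp; ring

theorem conj_phase (p q : ℝ × ℝ) : (starRingEnd ℂ) (phase p q) = phase p (-q) := by
  rw [phase, phase, ← Complex.exp_conj]
  congr 1; simp; ring

theorem fourierST_eq (φ : 𝓢(ℝ × ℝ, ℂ)) (q : ℝ × ℝ) : fourierST φ q = ∫ p, phase p q * φ p :=
  fourierST_apply φ q.1 q.2

theorem integrable_phase_mul {f g : ℝ × ℝ → ℂ} (hf : Integrable f) (hg : Integrable g) (s : ℝ) :
    Integrable (fun z : (ℝ × ℝ) × (ℝ × ℝ) => phase z.1 (s • z.2) * (f z.1 * g z.2))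
      (volume.prod volume) := by
  refine (hf.mul_prod hg).bdd_mul (c := 1) ?_ (Eventually.of_forall fun z => (norm_phase _ _).le)
  exact (continuous_phase.comp (by fun_prop : Continuous fun z : (ℝ × ℝ) × (ℝ × ℝ) =>
    (z.1, s • z.2))).aestronglyMeasurable

/-- The multiplication formula. -/
theorem integral_mul_fourierST {B : ℝ × ℝ → ℂ} (hB : Integrable B) (φ : 𝓢(ℝ × ℝ, ℂ)) :
    ∫ x, B x * fourierST φ x = ∫ q, (∫ x, phase x q * B x) * φ q := by
  have h := integrable_phase_mul hB (φ.integrable (μ := volume)) 1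
  calc _ = ∫ x, ∫ q, phase x q * (B x * φ q) := by
        refine integral_congr_ae (Eventually.of_forall fun x => ?_)
        simp only [fourierST_eq]
        rw [← integral_const_mul]
        refine integral_congr_ae (Eventually.of_forall fun q => ?_)
        simp only [phase_comm x q]; ring
    _ = ∫ q, ∫ x, phase x q * (B x * φ q) :=
        integral_integral_swap (by simpa [Function.uncurry_def] using h)
    _ = _ := by
        refine integral_congr_ae (Eventually.of_forall fun q => ?_)
        simp only
        rw [← integral_mul_const]
        simp only [mul_assoc]

/-- The inverse of `fourierST`. -/
def fourierSTInv : 𝓢(ℝ × ℝ, ℂ) →L[ℂ] 𝓢(ℝ × ℝ, ℂ) :=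
  (SchwartzMap.compCLMOfContinuousLinearEquiv ℂ
      (WithLp.prodContinuousLinearEquiv 2 ℝ ℝ ℝ).symm).comp
    ((FourierTransform.fourierInvCLM ℂ 𝓢(WithLp 2 (ℝ × ℝ), ℂ)).comp
      (SchwartzMap.compCLMOfContinuousLinearEquiv ℂ
        (angularScale.trans (WithLp.prodContinuousLinearEquiv 2 ℝ ℝ ℝ).symm).symm))

theorem fourierST_fourierSTInv (ψ : 𝓢(ℝ × ℝ, ℂ)) : fourierST (fourierSTInv ψ) = ψ := by
  have h : SchwartzMap.compCLMOfContinuousLinearEquiv ℂ (WithLp.prodContinuousLinearEquiv 2 ℝ ℝ ℝ)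
      (fourierSTInv ψ) = 𝓕⁻ (SchwartzMap.compCLMOfContinuousLinearEquiv ℂ
        (angularScale.trans (WithLp.prodContinuousLinearEquiv 2 ℝ ℝ ℝ).symm).symm ψ) := by
    ext x; simp [fourierSTInv]
  ext x
  simp only [fourierST, ContinuousLinearMap.comp_apply, h, FourierTransform.fourierCLM_apply,
    FourierTransform.fourier_fourierInv_eq]
  simp

theorem fourierSTInv_fourierST (ψ : 𝓢(ℝ × ℝ, ℂ)) : fourierSTInv (fourierST ψ) = ψ := by
  have h : SchwartzMap.compCLMOfContinuousLinearEquiv ℂ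
      (angularScale.trans (WithLp.prodContinuousLinearEquiv 2 ℝ ℝ ℝ).symm).symm
      (fourierST ψ) = 𝓕 (SchwartzMap.compCLMOfContinuousLinearEquiv ℂ
        (WithLp.prodContinuousLinearEquiv 2 ℝ ℝ ℝ) ψ) := by
    ext x; simp [fourierST]
  ext x
  simp only [fourierSTInv, ContinuousLinearMap.comp_apply, h, FourierTransform.fourierInvCLM_apply,
    FourierTransform.fourierInv_fourier_eq]
  simp

/-- Fourier inversion, `a(x) = (2π)⁻² ∬ e^{i x·P} â(P) dP`. -/
theorem fourierST_inversion (a : 𝓢(ℝ × ℝ, ℂ)) (x : ℝ × ℝ) :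
    a x = ((2 * Real.pi)⁻¹ ^ 2 : ℝ) * ∫ P, phase x (-P) * fourierST a P := by
  set A : 𝓢(WithLp 2 (ℝ × ℝ), ℂ) := SchwartzMap.compCLMOfContinuousLinearEquiv ℂ
    (WithLp.prodContinuousLinearEquiv 2 ℝ ℝ ℝ) a with hA
  have h1 : a x = 𝓕⁻ (𝓕 A) (WithLp.toLp 2 x) := by
    rw [FourierTransform.fourierInv_fourier_eq]; rfl
  rw [h1, SchwartzMap.fourierInv_coe, Real.fourierInv_eq',
    ← (WithLp.volume_preserving_toLp ℝ ℝ).integral_comp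
      (MeasurableEquiv.toLp 2 (ℝ × ℝ)).measurableEmbedding]
  have hpi : (2 * Real.pi)⁻¹ ≠ 0 := inv_ne_zero Real.two_pi_pos.ne'
  have h2 := Measure.integral_comp_smul (volume : Measure (ℝ × ℝ)) (fun p : ℝ × ℝ =>
    Complex.exp (↑(2 * Real.pi * inner ℝ (WithLp.toLp 2 p) (WithLp.toLp 2 x)) * Complex.I) •
      𝓕 A (WithLp.toLp 2 p)) (2 * Real.pi)⁻¹
  have hfin : Module.finrank ℝ (ℝ × ℝ) = 2 := by simp
  have h3 : ∀ P : ℝ × ℝ, phase x (-P) * fourierST a P =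
      Complex.exp (↑(2 * Real.pi * inner ℝ (WithLp.toLp 2 ((2 * Real.pi)⁻¹ • P))
        (WithLp.toLp 2 x)) * Complex.I) • 𝓕 A (WithLp.toLp 2 ((2 * Real.pi)⁻¹ • P)) := by
    intro P
    rw [smul_eq_mul]
    congr 1
    rw [phase]
    congr 1
    have hpi' : (Real.pi : ℂ) ≠ 0 := by exact_mod_cast Real.pi_ne_zero
    simp [WithLp.prod_inner_apply]
    field_simp
    ring
  simp only [h3]
  rw [h2, hfin, abs_of_pos (by positivity), inv_pow, inv_inv, Complex.real_smul, ← mul_assoc,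
    ← Complex.ofReal_mul, inv_mul_cancel₀ (by positivity), Complex.ofReal_one, one_mul]

/-- An operation `κ` on the second factor of a product of Schwartz functions, together with the
number `e` such that the Fourier transform of `κ ∘ b` is `κ` of that of `b`, reflected by `e`.
The instances used are the identity with `e = 1` and conjugation with `e = -1`. -/
def FourierCompatible (κ : ℂ ≃ₗᵢ[ℝ] ℂ) (e : ℝ) : Prop :=
  ∀ b φ : 𝓢(ℝ × ℝ, ℂ), ∫ x, κ (b x) * fourierST φ x = ∫ Q, κ (fourierST b Q) * φ (e • Q)

theorem fourierCompatible_refl : FourierCompatible (LinearIsometryEquiv.refl ℝ ℂ) 1 := by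
  intro b φ
  simp only [LinearIsometryEquiv.coe_refl, id, one_smul]
  rw [integral_mul_fourierST b.integrable]
  refine integral_congr_ae (Eventually.of_forall fun q => ?_)
  simp only [fourierST_eq]

theorem fourierCompatible_conj : FourierCompatible Complex.conjLIE (-1) := by
  intro b φ
  have hb : Integrable fun x => Complex.conjLIE (b x) :=
    Complex.conjLIE.toContinuousLinearEquiv.toContinuousLinearMap.integrable_comp b.integrable
  rw [integral_mul_fourierST hb, ← integral_neg_eq_self]
  refine integral_congr_ae (Eventually.of_forall fun q => ?_)
  simp only [neg_smul, one_smul]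
  congr 1
  rw [fourierST_eq, Complex.conjLIE_apply, ← integral_conj]
  refine integral_congr_ae (Eventually.of_forall fun x => ?_)
  simp only [map_mul, conj_phase, Complex.conjLIE_apply, phase_comm x]
  simp [phase]

/-- The Fourier transform turns products into convolutions, tested against a Schwartz function. -/
theorem integral_mul_mul_fourierST {κ : ℂ ≃ₗᵢ[ℝ] ℂ} {e : ℝ} (hκ : FourierCompatible κ e)
    (a b ψ : 𝓢(ℝ × ℝ, ℂ)) :
    ∫ x, a x * κ (b x) * fourierST ψ x = ((2 * Real.pi)⁻¹ ^ 2 : ℝ) *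
      ∫ Q, ∫ P, fourierST a P * κ (fourierST b Q) * ψ (P + e • Q) := by
  have hsw : Integrable (Function.uncurry fun P Q : ℝ × ℝ =>
      fourierST a P * κ (fourierST b Q) * ψ (P + e • Q)) (volume.prod volume) :=
    ((fourierST a).integrable.mul_prod
      (κ.toContinuousLinearEquiv.toContinuousLinearMap.integrable_comp
        (fourierST b).integrable)).mul_bdd (c := SchwartzMap.seminorm ℝ 0 0 ψ)
      (ψ.continuous.comp (by fun_prop : Continuous fun z : (ℝ × ℝ) × (ℝ × ℝ) =>
        z.1 + e • z.2)).aestronglyMeasurable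
      (Eventually.of_forall fun z => ψ.norm_le_seminorm ℝ _)
  rw [← integral_integral_swap hsw]
  have hb : Integrable fun x => κ (b x) * fourierST ψ x :=
    (κ.toContinuousLinearEquiv.toContinuousLinearMap.integrable_comp b.integrable).mul_schwartz _
  have mod : ∀ P x : ℝ × ℝ, phase x (-P) * fourierST ψ x =
      fourierST (ψ.compSubConstCLM ℂ (-P)) x := by
    intro P x
    rw [fourierST_eq, fourierST_eq, ← integral_const_mul]
    simp only [SchwartzMap.compSubConstCLM_apply, sub_neg_eq_add]
    rw [← integral_sub_right_eq_self (fun q => phase q x * ψ (q + P)) P]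
    refine integral_congr_ae (Eventually.of_forall fun q => ?_)
    simp only [sub_add_cancel, phase_comm _ x, phase_sub_right x q P]
    ring
  have h := integrable_phase_mul hb (fourierST a).integrable (-1)
  calc _ = ((2 * Real.pi)⁻¹ ^ 2 : ℝ) *
        ∫ x, ∫ P, phase x (-P) * ((κ (b x) * fourierST ψ x) * fourierST a P) := by
        rw [← integral_const_mul]
        refine integral_congr_ae (Eventually.of_forall fun x => ?_)
        simp only
        rw [fourierST_inversion a x, mul_assoc, mul_assoc]
        congr 1
        rw [← integral_mul_const]
        refine integral_congr_ae (Eventually.of_forall fun P => ?_)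
        simp only
        ring
    _ = ((2 * Real.pi)⁻¹ ^ 2 : ℝ) *
        ∫ P, ∫ x, phase x (-P) * ((κ (b x) * fourierST ψ x) * fourierST a P) := by
        rw [integral_integral_swap (by simpa [Function.uncurry_def] using h)]
    _ = _ := by
        congr 1
        refine integral_congr_ae (Eventually.of_forall fun P => ?_)
        simp only
        calc _ = fourierST a P * ∫ x, κ (b x) * fourierST (ψ.compSubConstCLM ℂ (-P)) x := by
              rw [← integral_const_mul]
              refine integral_congr_ae (Eventually.of_forall fun x => ?_)
              simp only [← mod]
              ring
          _ = _ := by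
              rw [hκ, ← integral_const_mul]
              refine integral_congr_ae (Eventually.of_forall fun Q => ?_)
              simp only [SchwartzMap.compSubConstCLM_apply, sub_neg_eq_add, add_comm P]
              ring

/-! ### Distributions whose Fourier transform is a function -/

/-- For Schwartz functions, the multiplication formula makes the two Fourier transforms agree. -/
theorem hasFourier_schwartz (a : 𝓢(ℝ × ℝ, ℂ)) :
    HasFourier (a : 𝓢'(ℝ × ℝ, ℂ)) (fourierST a) := by
  refine ⟨(fourierST a).continuous.aestronglyMeasurable, fun φ => ⟨?_, ?_⟩⟩
  · exact (fourierST a).integrable.mul_schwartz φ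
  · rw [SchwartzMap.coe_apply]
    have := fourierCompatible_refl a φ
    simp only [LinearIsometryEquiv.coe_refl, id, one_smul] at this
    rw [← this]
    simp only [smul_eq_mul, mul_comm]

theorem HasFourier.sub {z₁ z₂ : 𝓢'(ℝ × ℝ, ℂ)} {f₁ f₂ : ℝ × ℝ → ℂ} (h₁ : HasFourier z₁ f₁)
    (h₂ : HasFourier z₂ f₂) : HasFourier (z₁ - z₂) (f₁ - f₂) := by
  refine ⟨h₁.1.sub h₂.1, fun φ => ?_⟩
  have i₁ := (h₁.2 φ).1
  have i₂ := (h₂.2 φ).1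
  simp only [Pi.sub_apply, sub_mul]
  refine ⟨i₁.sub i₂, ?_⟩
  rw [integral_sub i₁ i₂, ← (h₁.2 φ).2, ← (h₂.2 φ).2]
  rfl

theorem HasFourier.congr {z : 𝓢'(ℝ × ℝ, ℂ)} {f g : ℝ × ℝ → ℂ} (h : HasFourier z f)
    (hfg : f =ᵐ[volume] g) : HasFourier z g := by
  refine ⟨h.1.congr hfg, fun φ => ?_⟩
  have e : (fun p => f p * φ p) =ᵐ[volume] fun p => g p * φ p := by
    filter_upwards [hfg] with p hp; rw [hp]
  exact ⟨(h.2 φ).1.congr e, (h.2 φ).2.trans (integral_congr_ae e)⟩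

/-- The function representing the Fourier transform of a tempered distribution is unique. Pairing
with bump functions first shows it to be locally integrable. -/
theorem HasFourier.ae_eq {z : 𝓢'(ℝ × ℝ, ℂ)} {f g : ℝ × ℝ → ℂ} (hf : HasFourier z f)
    (hg : HasFourier z g) : f =ᵐ[volume] g := by
  have hloc : ∀ {f}, HasFourier z f → LocallyIntegrable f volume := by
    intro f hf x
    let β : ContDiffBump x := ⟨1, 2, one_pos, one_lt_two⟩
    have hg₁ : HasCompactSupport (Complex.ofRealCLM ∘ β) := β.hasCompactSupport.comp_left rfl
    have hg₂ : ContDiff ℝ (⊤ : ℕ∞) (Complex.ofRealCLM ∘ β) :=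
      Complex.ofRealCLM.contDiff.comp β.contDiff
    refine ⟨Metric.closedBall x 1, Metric.closedBall_mem_nhds x one_pos, ?_⟩
    refine ((hf.2 (hg₁.toSchwartzMap hg₂)).1.integrableOn (s := Metric.closedBall x 1)).congr_fun
      (fun p hp => ?_) Metric.isClosed_closedBall.measurableSet
    simp [β.one_of_mem_closedBall hp]
  refine ae_eq_of_integral_contDiff_smul_eq (hloc hf) (hloc hg) fun η hη hcpt => ?_
  have hg₁ : HasCompactSupport (Complex.ofRealCLM ∘ η) := hcpt.comp_left rfl
  have hg₂ : ContDiff ℝ (⊤ : ℕ∞) (Complex.ofRealCLM ∘ η) := Complex.ofRealCLM.contDiff.comp hη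
  have e := (hf.2 (hg₁.toSchwartzMap hg₂)).2.symm.trans (hg.2 (hg₁.toSchwartzMap hg₂)).2
  simpa [mul_comm] using e

theorem fourierWeightedNorm_eq {w : ℝ × ℝ → ℝ} {z : 𝓢'(ℝ × ℝ, ℂ)} {f : ℝ × ℝ → ℂ}
    (hf : HasFourier z f) : fourierWeightedNorm w z = weightedNorm w fun p => ‖f p‖ₑ := by
  refine le_antisymm (iInf₂_le f hf) (le_iInf₂ fun g hg => le_of_eq ?_)
  rw [weightedNorm]
  congr 1
  refine lintegral_congr_ae ?_
  filter_upwards [hf.ae_eq hg] with p hp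
  rw [hp]

/-- If the norm is finite then the infimum defining it is not over the empty set. -/
theorem exists_hasFourier_of_norm_lt_top {w : ℝ × ℝ → ℝ} {z : 𝓢'(ℝ × ℝ, ℂ)}
    (h : fourierWeightedNorm w z < ∞) : ∃ f, StronglyMeasurable f ∧ HasFourier z f := by
  by_contra! H
  refine h.ne (iInf₂_eq_top.2 fun f hf => absurd (hf.congr hf.1.ae_eq_mk) (H _ ?_))
  exact hf.1.stronglyMeasurable_mk

/-- The transpose of `∂ₓ` on the Fourier side is multiplication by `iξ`. -/
theorem lineDeriv_fourierST (φ : 𝓢(ℝ × ℝ, ℂ)) :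
    ∃ χ : 𝓢(ℝ × ℝ, ℂ), (∀ p, χ p = Complex.I * p.1 * φ p) ∧
      -∂_{((1, 0) : ℝ × ℝ)} (fourierST φ) = fourierST χ := by
  have ht : (fun p : ℝ × ℝ => Complex.I * (p.1 : ℂ)).HasTemperateGrowth := by
    have : (fun p : ℝ × ℝ => (p.1 : ℂ)).HasTemperateGrowth :=
      (Complex.ofRealCLM.comp (ContinuousLinearMap.fst ℝ ℝ ℝ)).hasTemperateGrowth
    fun_prop
  refine ⟨SchwartzMap.smulLeftCLM ℂ (fun p : ℝ × ℝ => Complex.I * (p.1 : ℂ)) φ, fun p => ?_, ?_⟩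
  · rw [SchwartzMap.smulLeftCLM_apply_apply ht, smul_eq_mul]
  set A : 𝓢(WithLp 2 (ℝ × ℝ), ℂ) := SchwartzMap.compCLMOfContinuousLinearEquiv ℂ
    (WithLp.prodContinuousLinearEquiv 2 ℝ ℝ ℝ) φ with hA
  have h1 : fourierST φ = SchwartzMap.compCLMOfContinuousLinearEquiv ℂ
      (angularScale.trans (WithLp.prodContinuousLinearEquiv 2 ℝ ℝ ℝ).symm) (𝓕 A) := rfl
  set m := (angularScale.trans (WithLp.prodContinuousLinearEquiv 2 ℝ ℝ ℝ).symm) (1, 0) with hm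
  have hin : (inner ℝ · m).HasTemperateGrowth := ((innerSL ℝ).flip m).hasTemperateGrowth
  have h2 : SchwartzMap.compCLMOfContinuousLinearEquiv ℂ (WithLp.prodContinuousLinearEquiv 2 ℝ ℝ ℝ)
      (SchwartzMap.smulLeftCLM ℂ (fun p : ℝ × ℝ => Complex.I * (p.1 : ℂ)) φ) =
      -(-(2 * Real.pi * Complex.I) • SchwartzMap.smulLeftCLM ℂ (inner ℝ · m) A) := by
    ext x
    have hpi : (Real.pi : ℂ) ≠ 0 := by exact_mod_cast Real.pi_ne_zero
    have hinner : inner ℝ x m = (2 * Real.pi)⁻¹ * x.ofLp.1 := by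
      rw [show m = WithLp.toLp 2 ((2 * Real.pi)⁻¹ • ((1, 0) : ℝ × ℝ)) from rfl,
        WithLp.prod_inner_apply]
      simp
    have hAx : A x = φ x.ofLp := rfl
    rw [SchwartzMap.compCLMOfContinuousLinearEquiv_apply, neg_smul, neg_neg, smul_apply,
      SchwartzMap.smulLeftCLM_apply_apply hin, hinner, hAx, Function.comp_apply,
      SchwartzMap.smulLeftCLM_apply_apply ht]
    simp
    field_simp
  rw [h1, SchwartzMap.lineDerivOp_compCLMOfContinuousLinearEquiv, ← hm,
    SchwartzMap.lineDerivOp_fourier_eq, ← map_neg, ← FourierTransform.fourier_neg]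
  ext x
  simp only [fourierST, ContinuousLinearMap.comp_apply, h2]
  rfl

theorem hasFourier_partialX {z : 𝓢'(ℝ × ℝ, ℂ)} {f : ℝ × ℝ → ℂ} (h : HasFourier z f) :
    HasFourier (partialX z) fun p => Complex.I * p.1 * f p := by
  refine ⟨?_, fun φ => ?_⟩
  · exact AEStronglyMeasurable.mul (Continuous.aestronglyMeasurable (by fun_prop)) h.1
  obtain ⟨χ, hχ, hd⟩ := lineDeriv_fourierST φ
  have e : (fun p => Complex.I * p.1 * f p * φ p) = fun p => f p * χ p := by
    ext p; rw [hχ]; ring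
  rw [e]
  refine ⟨(h.2 χ).1, ?_⟩
  rw [← (h.2 χ).2, ← hd]
  rfl

/-! ### Polynomially growing weights -/

/-- A positive continuous weight of at most polynomial growth. -/
structure IsPolyWeight (w : ℝ × ℝ → ℝ) : Prop where
  continuous : Continuous w
  pos : ∀ p, 0 < w p
  growth : ∃ (n : ℕ) (C : ℝ), ∀ p, w p ≤ C * (1 + ‖p‖) ^ n

/-- The measure with density `w`; its `L²` norm is the weighted norm. -/
def weightMeasure (w : ℝ × ℝ → ℝ) : Measure (ℝ × ℝ) :=
  volume.withDensity fun p => ENNReal.ofReal (w p)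

theorem lintegral_weight_lt_top {w : ℝ × ℝ → ℝ} (hw : Continuous w) {K : Set (ℝ × ℝ)}
    (hK : IsCompact K) : ∫⁻ p in K, ENNReal.ofReal (w p) < ∞ := by
  have h := (hw.norm.continuousOn.integrableOn_compact hK (μ := volume)).2
  refine lt_of_le_of_lt (lintegral_mono fun p => ?_) h
  simp only [Real.enorm_eq_ofReal_abs]
  exact ENNReal.ofReal_le_ofReal ((le_abs_self _).trans (le_abs_self _))

theorem IsPolyWeight.isFiniteMeasureOnCompacts {w : ℝ × ℝ → ℝ} (hw : IsPolyWeight w) :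
    IsFiniteMeasureOnCompacts (weightMeasure w) := by
  refine ⟨fun K hK => ?_⟩
  rw [weightMeasure, withDensity_apply _ hK.measurableSet]
  exact lintegral_weight_lt_top hw.continuous hK

theorem IsPolyWeight.hasTemperateGrowth {w : ℝ × ℝ → ℝ} (hw : IsPolyWeight w) :
    (weightMeasure w).HasTemperateGrowth := by
  obtain ⟨n, C, hC⟩ := hw.growth
  refine ⟨⟨n + 3, ?_⟩⟩
  have hm : Measurable fun p => ENNReal.ofReal (w p) := hw.continuous.measurable.ennreal_ofReal
  rw [weightMeasure, integrable_withDensity_iff hm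
    (Eventually.of_forall fun p => ENNReal.ofReal_lt_top)]
  have hint : Integrable (fun p : ℝ × ℝ => C * (1 + ‖p‖) ^ (-(3 : ℝ))) :=
    (integrable_one_add_norm (by simp; norm_num)).const_mul C
  have hpos : ∀ p : ℝ × ℝ, 0 < 1 + ‖p‖ := fun p => by positivity
  refine hint.mono' ?_ (Eventually.of_forall fun p => ?_)
  · refine Continuous.aestronglyMeasurable (Continuous.mul ?_ ?_)
    · exact Continuous.rpow_const (by fun_prop) fun p => Or.inl (hpos p).ne'
    · simp only [ENNReal.toReal_ofReal (hw.pos _).le]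
      exact hw.continuous
  · rw [ENNReal.toReal_ofReal (hw.pos p).le, Real.norm_of_nonneg
      (mul_nonneg (Real.rpow_nonneg (hpos p).le _) (hw.pos p).le)]
    calc _ ≤ (1 + ‖p‖) ^ (-((n + 3 : ℕ) : ℝ)) * (C * (1 + ‖p‖) ^ n) :=
          mul_le_mul_of_nonneg_left (hC p) (Real.rpow_nonneg (hpos p).le _)
      _ = _ := by
          rw [mul_left_comm, ← Real.rpow_natCast (1 + ‖p‖) n, ← Real.rpow_add (hpos p)]
          congr 2
          push_cast; ring

theorem eLpNorm_weightMeasure {w : ℝ × ℝ → ℝ} (hw : IsPolyWeight w) {f : ℝ × ℝ → ℂ}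
    (hf : Measurable f) : eLpNorm f 2 (weightMeasure w) = weightedNorm w fun p => ‖f p‖ₑ := by
  rw [eLpNorm_eq_lintegral_rpow_enorm_toReal (by norm_num) (by norm_num), weightMeasure,
    lintegral_withDensity_eq_lintegral_mul _ hw.continuous.measurable.ennreal_ofReal (by fun_prop),
    weightedNorm]
  simp

theorem weightedNorm_schwartz_lt_top {w : ℝ × ℝ → ℝ} (hw : IsPolyWeight w) (ψ : 𝓢(ℝ × ℝ, ℂ)) :
    weightedNorm w (fun p => ‖ψ p‖ₑ) < ∞ := by
  have := hw.hasTemperateGrowth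
  rw [← eLpNorm_weightMeasure hw ψ.continuous.measurable]
  exact ψ.eLpNorm_lt_top 2 _

/-- A linear functional on Schwartz space bounded by a weighted norm is continuous. -/
theorem exists_clm_of_le_weightedNorm {w : ℝ × ℝ → ℝ} (hw : IsPolyWeight w)
    (ℓ : 𝓢(ℝ × ℝ, ℂ) →ₗ[ℂ] ℂ) {K : ℝ≥0∞} (hK : K ≠ ∞)
    (hℓ : ∀ ψ, ‖ℓ ψ‖ₑ ≤ K * weightedNorm w fun p => ‖ψ p‖ₑ) :
    ∃ L : 𝓢(ℝ × ℝ, ℂ) →L[ℂ] ℂ, ∀ ψ, L ψ = ℓ ψ := by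
  have := hw.hasTemperateGrowth
  obtain ⟨k, D, hD0, hD⟩ := SchwartzMap.norm_toLp_le_seminorm ℂ ℂ (E := ℝ × ℝ) 2 (weightMeasure w)
  refine ⟨SchwartzMap.mkCLMtoNormedSpace ℓ (fun f g => map_add ℓ f g) (fun a f => map_smul ℓ a f)
    ⟨Finset.Iic (k, 0), K.toReal * D, by positivity, fun ψ => ?_⟩, fun ψ => rfl⟩
  have h1 : ‖ℓ ψ‖ ≤ K.toReal * ‖ψ.toLp 2 (weightMeasure w)‖ := by
    rw [SchwartzMap.norm_toLp, ← ENNReal.toReal_mul, ← toReal_enorm]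
    refine ENNReal.toReal_mono (ENNReal.mul_ne_top hK (ψ.eLpNorm_lt_top 2 _).ne) ?_
    rw [eLpNorm_weightMeasure hw ψ.continuous.measurable]
    exact hℓ ψ
  rw [mul_assoc]
  exact h1.trans (mul_le_mul_of_nonneg_left (hD ψ) ENNReal.toReal_nonneg)

/-- Schwartz functions are dense in the spaces defined by polynomially growing weights. -/
theorem exists_schwartz_tendsto {w : ℝ × ℝ → ℝ} (hw : IsPolyWeight w) {z : 𝓢'(ℝ × ℝ, ℂ)}
    (hz : fourierWeightedNorm w z < ∞) : ∃ a : ℕ → 𝓢(ℝ × ℝ, ℂ),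
      Tendsto (fun k => fourierWeightedNorm w ((a k : 𝓢'(ℝ × ℝ, ℂ)) - z)) atTop (𝓝 0) := by
  have := hw.hasTemperateGrowth
  have := hw.isFiniteMeasureOnCompacts
  obtain ⟨f, hfm, hf⟩ := exists_hasFourier_of_norm_lt_top hz
  have hmem : MemLp f 2 (weightMeasure w) := by
    refine ⟨hfm.aestronglyMeasurable, ?_⟩
    rwa [eLpNorm_weightMeasure hw hfm.measurable, ← fourierWeightedNorm_eq hf]
  have key : ∀ k : ℕ, ∃ a : 𝓢(ℝ × ℝ, ℂ), fourierWeightedNorm w ((a : 𝓢'(ℝ × ℝ, ℂ)) - z) ≤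
      ENNReal.ofReal (1 / ((k : ℝ) + 1)) := by
    intro k
    obtain ⟨g, hg₁, hg₂, hg₃⟩ := hmem.exist_eLpNorm_sub_le (by norm_num) (by norm_num)
      (ε := 1 / ((k : ℝ) + 1)) (by positivity)
    refine ⟨fourierSTInv (hg₁.toSchwartzMap hg₂), ?_⟩
    have h1 := (hasFourier_schwartz (fourierSTInv (hg₁.toSchwartzMap hg₂))).sub hf
    rw [fourierST_fourierSTInv] at h1
    have h2 : Measurable (⇑(hg₁.toSchwartzMap hg₂) - f) :=
      (hg₁.toSchwartzMap hg₂).continuous.measurable.sub hfm.measurable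
    rw [fourierWeightedNorm_eq h1, ← eLpNorm_weightMeasure hw h2]
    rw [← eLpNorm_neg, neg_sub]
    exact hg₃
  choose a ha using key
  refine ⟨a, tendsto_of_tendsto_of_tendsto_of_le_of_le tendsto_const_nhds ?_
    (fun k => zero_le) ha⟩
  rw [← ENNReal.ofReal_zero]
  exact ENNReal.tendsto_ofReal tendsto_one_div_add_atTop_nhds_zero_nat

/-- The dual of a weighted `L²` space is that of the inverse weight. The converse of Hölder's
inequality is applied to `h = w⁻¹ m` for truncations `m` of `G`. -/
theorem weightedNorm_inv_le_of_dual {w : ℝ × ℝ → ℝ} (hw : Continuous w) (hpos : ∀ p, 0 < w p)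
    {G : ℝ × ℝ → ℝ≥0∞} (hG : Measurable G) {K : ℝ≥0∞}
    (hK : ∀ h : ℝ × ℝ → ℝ≥0∞, Measurable h → ∫⁻ p, G p * h p ≤ K * weightedNorm w h) :
    weightedNorm (fun p => (w p)⁻¹) G ≤ K := by
  set v : ℝ × ℝ → ℝ≥0∞ := fun p => ENNReal.ofReal (w p)⁻¹ with hv
  have hvc : Continuous fun p => (w p)⁻¹ := hw.inv₀ fun p => (hpos p).ne'
  have mv : Measurable v := hvc.measurable.ennreal_ofReal
  -- Truncations of `G`, for which the norm in question is known to be finite.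
  set m : ℕ → ℝ × ℝ → ℝ≥0∞ := fun n =>
    (Metric.closedBall (0 : ℝ × ℝ) n).indicator fun p => min (G p) n with hm
  have mm : ∀ n, Measurable (m n) := fun n =>
    (hG.min measurable_const).indicator Metric.isClosed_closedBall.measurableSet
  have mle : ∀ n p, m n p ≤ G p := fun n p =>
    (Set.indicator_le_self _ _ _).trans (min_le_left _ _)
  have hJ : ∀ n, ∫⁻ p, v p * m n p ^ 2 ≤ K ^ 2 := by
    intro n
    set J := ∫⁻ p, v p * m n p ^ 2 with hJdef
    have hfin : J ≠ ∞ := by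
      have h1 : J ≤ ∫⁻ p in Metric.closedBall (0 : ℝ × ℝ) n, v p * (n : ℝ≥0∞) ^ 2 := by
        rw [hJdef, ← lintegral_indicator Metric.isClosed_closedBall.measurableSet]
        refine lintegral_mono fun p => ?_
        by_cases hp : p ∈ Metric.closedBall (0 : ℝ × ℝ) n
        · simp only [hm, Set.indicator_of_mem hp]
          gcongr
          exact min_le_right _ _
        · simp only [hm, Set.indicator_of_notMem hp]; simp
      refine (h1.trans_lt ?_).ne
      rw [lintegral_mul_const _ mv]
      exact ENNReal.mul_lt_top (lintegral_weight_lt_top hvc (isCompact_closedBall _ _))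
        (by simp)
    have h2 : J ≤ K * J ^ (1 / 2 : ℝ) := by
      calc J ≤ ∫⁻ p, G p * (v p * m n p) := by
            refine lintegral_mono fun p => ?_
            calc v p * m n p ^ 2 = m n p * (v p * m n p) := by ring
              _ ≤ _ := mul_le_mul_left (mle n p) _
        _ ≤ K * weightedNorm w (fun p => v p * m n p) := hK _ (mv.mul (mm n))
        _ = K * J ^ (1 / 2 : ℝ) := by
            rw [weightedNorm, hJdef]
            congr 3
            ext p
            have : ENNReal.ofReal (w p) * v p = 1 := by
              rw [hv, ← ENNReal.ofReal_mul (hpos p).le, mul_inv_cancel₀ (hpos p).ne']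
              simp
            calc _ = (ENNReal.ofReal (w p) * v p) * (v p * m n p ^ 2) := by ring
              _ = _ := by rw [this, one_mul]
    have hsq : J = J ^ (1 / 2 : ℝ) * J ^ (1 / 2 : ℝ) := by
      rw [← ENNReal.rpow_add_of_nonneg _ _ (by norm_num) (by norm_num)]; norm_num
    rcases eq_or_ne J 0 with h0 | h0
    · rw [h0]; exact zero_le
    have h3 : J ^ (1 / 2 : ℝ) ≤ K := by
      have hr0 : J ^ (1 / 2 : ℝ) ≠ 0 := by simp [h0]
      have hrt : J ^ (1 / 2 : ℝ) ≠ ∞ := by simp [hfin]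
      exact (ENNReal.mul_le_mul_iff_left hr0 hrt).1 (hsq.symm.le.trans h2)
    rw [hsq, sq]
    exact mul_le_mul' h3 h3
  have hlim : ∀ p, Tendsto (fun n => v p * m n p ^ 2) atTop (𝓝 (v p * G p ^ 2)) := by
    intro p
    refine ENNReal.Tendsto.const_mul ?_ (Or.inr ENNReal.ofReal_ne_top)
    refine ENNReal.Tendsto.pow ?_
    have h1 : Tendsto (fun n : ℕ => min (G p) (n : ℝ≥0∞)) atTop (𝓝 (min (G p) ∞)) :=
      tendsto_const_nhds.min ENNReal.tendsto_nat_nhds_top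
    rw [min_top_right] at h1
    refine h1.congr' ?_
    obtain ⟨N, hN⟩ := exists_nat_ge ‖p‖
    filter_upwards [eventually_ge_atTop N] with n hn
    rw [hm]
    simp only
    rw [Set.indicator_of_mem]
    simp only [Metric.mem_closedBall, dist_zero_right]
    exact hN.trans (by exact_mod_cast hn)
  have hF : ∫⁻ p, v p * G p ^ 2 ≤ K ^ 2 := by
    calc _ = ∫⁻ p, liminf (fun n => v p * m n p ^ 2) atTop :=
          lintegral_congr fun p => (hlim p).liminf_eq.symm
      _ ≤ liminf (fun n => ∫⁻ p, v p * m n p ^ 2) atTop :=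
          lintegral_liminf_le fun n => mv.mul ((mm n).pow_const 2)
      _ ≤ liminf (fun _ : ℕ => K ^ 2) atTop := liminf_le_liminf (Eventually.of_forall hJ)
      _ = K ^ 2 := by simp
  calc weightedNorm (fun p => (w p)⁻¹) G ≤ (K ^ 2) ^ (1 / 2 : ℝ) :=
        ENNReal.rpow_le_rpow hF (by norm_num)
    _ = K := by
        rw [← ENNReal.rpow_natCast, ← ENNReal.rpow_mul]; norm_num

/-! ### Products defined by a trilinear estimate -/

/-- The trilinear estimate with weights `w₁`, `w₂`, `w₃` and constant `C`, for the frequency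
relation `R = P + e Q`. -/
def TrilinearBound (e : ℝ) (w₁ w₂ w₃ : ℝ × ℝ → ℝ) (C : ℝ≥0) : Prop :=
  ∀ f g h : ℝ × ℝ → ℝ≥0∞, Measurable f → Measurable g → Measurable h →
    ∫⁻ Q, ∫⁻ P, f P * g Q * h (P + e • Q) ≤
      C * (weightedNorm w₁ f * weightedNorm w₂ g * weightedNorm w₃ h)

/-- The integrand of the trilinear form, in the variables `z = (R, Q)` with `R = P + e Q`. -/
def triIntegrand (κ : ℂ ≃ₗᵢ[ℝ] ℂ) (e : ℝ) (f g ψ : ℝ × ℝ → ℂ) (z : (ℝ × ℝ) × (ℝ × ℝ)) : ℂ :=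
  f (z.1 - e • z.2) * κ (g z.2) * ψ z.1

section

variable {κ : ℂ ≃ₗᵢ[ℝ] ℂ} {e : ℝ} {w₁ w₂ w₃ : ℝ × ℝ → ℝ} {C : ℝ≥0} {f g ψ : ℝ × ℝ → ℂ}

theorem measurable_triIntegrand (hf : Measurable f) (hg : Measurable g) (hψ : Measurable ψ) :
    Measurable (triIntegrand κ e f g ψ) := by
  have := κ.continuous.measurable
  unfold triIntegrand
  fun_prop

theorem TrilinearBound.lintegral_translate_le (hT : TrilinearBound e w₁ w₂ w₃ C)
    {f g h : ℝ × ℝ → ℝ≥0∞} (hf : Measurable f) (hg : Measurable g) (hh : Measurable h) :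
    ∫⁻ R, ∫⁻ Q, f (R - e • Q) * g Q * h R ≤
      C * (weightedNorm w₁ f * weightedNorm w₂ g * weightedNorm w₃ h) := by
  rw [lintegral_lintegral_swap (Measurable.aemeasurable (by unfold Function.uncurry; fun_prop))]
  refine le_of_eq_of_le (lintegral_congr fun Q => ?_) (hT f g h hf hg hh)
  rw [← lintegral_add_right_eq_self _ (e • Q)]
  simp only [add_sub_cancel_right]

theorem TrilinearBound.lintegral_enorm_le (hT : TrilinearBound e w₁ w₂ w₃ C) (hf : Measurable f)
    (hg : Measurable g) (hψ : Measurable ψ) :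
    ∫⁻ z, ‖triIntegrand κ e f g ψ z‖ₑ ∂(volume.prod volume) ≤
      C * (weightedNorm w₁ (fun p => ‖f p‖ₑ) * weightedNorm w₂ (fun p => ‖g p‖ₑ) *
        weightedNorm w₃ fun p => ‖ψ p‖ₑ) := by
  rw [lintegral_prod _ (measurable_triIntegrand hf hg hψ).enorm.aemeasurable]
  simp only [triIntegrand, enorm_mul, LinearIsometryEquiv.enorm_map]
  exact hT.lintegral_translate_le hf.enorm hg.enorm hψ.enorm

theorem TrilinearBound.integrable (hT : TrilinearBound e w₁ w₂ w₃ C) (hf : Measurable f)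
    (hg : Measurable g) (hψ : Measurable ψ) (hf' : weightedNorm w₁ (fun p => ‖f p‖ₑ) < ∞)
    (hg' : weightedNorm w₂ (fun p => ‖g p‖ₑ) < ∞) (hψ' : weightedNorm w₃ (fun p => ‖ψ p‖ₑ) < ∞) :
    Integrable (triIntegrand κ e f g ψ) (volume.prod volume) :=
  ⟨(measurable_triIntegrand hf hg hψ).aestronglyMeasurable,
    (hT.lintegral_enorm_le hf hg hψ).trans_lt (ENNReal.mul_lt_top ENNReal.coe_lt_top
      (ENNReal.mul_lt_top (ENNReal.mul_lt_top hf' hg') hψ'))⟩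

/-- The Fourier transform of the product: a normalised convolution. -/
def productFourier (κ : ℂ ≃ₗᵢ[ℝ] ℂ) (e : ℝ) (f g : ℝ × ℝ → ℂ) (R : ℝ × ℝ) : ℂ :=
  ((2 * Real.pi)⁻¹ ^ 2 : ℝ) * ∫ Q, f (R - e • Q) * κ (g Q)

theorem stronglyMeasurable_productFourier (hf : Measurable f) (hg : Measurable g) :
    StronglyMeasurable (productFourier κ e f g) := by
  have := κ.continuous.measurable
  have h : StronglyMeasurable fun z : (ℝ × ℝ) × (ℝ × ℝ) => f (z.1 - e • z.2) * κ (g z.2) :=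
    Measurable.stronglyMeasurable (by fun_prop)
  exact h.integral_prod_right'.const_mul _

theorem integral_productFourier_mul
    (h : Integrable (triIntegrand κ e f g ψ) (volume.prod volume)) :
    Integrable (fun R => productFourier κ e f g R * ψ R) ∧
      ((2 * Real.pi)⁻¹ ^ 2 : ℝ) * ∫ z, triIntegrand κ e f g ψ z ∂(volume.prod volume) =
        ∫ R, productFourier κ e f g R * ψ R := by
  have e1 : ∀ R, productFourier κ e f g R * ψ R =
      ((2 * Real.pi)⁻¹ ^ 2 : ℝ) * ∫ Q, triIntegrand κ e f g ψ (R, Q) := by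
    intro R
    simp only [productFourier, triIntegrand]
    rw [integral_mul_const, mul_assoc]
  simp only [e1]
  refine ⟨h.integral_prod_left.const_mul _, ?_⟩
  rw [integral_const_mul, integral_prod _ h]

theorem TrilinearBound.weightedNorm_productFourier_le (hT : TrilinearBound e w₁ w₂ w₃ C)
    (hw₃ : IsPolyWeight w₃) (hf : Measurable f) (hg : Measurable g) :
    weightedNorm (fun p => (w₃ p)⁻¹) (fun p => ‖productFourier κ e f g p‖ₑ) ≤
      C * (weightedNorm w₁ (fun p => ‖f p‖ₑ) * weightedNorm w₂ fun p => ‖g p‖ₑ) := by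
  set G : ℝ × ℝ → ℝ≥0∞ := fun R => ∫⁻ Q, ‖f (R - e • Q)‖ₑ * ‖g Q‖ₑ with hG
  have mfg : Measurable fun z : (ℝ × ℝ) × (ℝ × ℝ) => ‖f (z.1 - e • z.2)‖ₑ * ‖g z.2‖ₑ := by fun_prop
  have hGm : Measurable G := mfg.lintegral_prod_right'
  have hle : ∀ R, ‖productFourier κ e f g R‖ₑ ≤ G R := by
    intro R
    have hc : ‖(((2 * Real.pi)⁻¹ ^ 2 : ℝ) : ℂ)‖ₑ ≤ 1 := by
      rw [← ofReal_norm, Complex.norm_real, Real.norm_of_nonneg (by positivity)]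
      rw [← ENNReal.ofReal_one]
      refine ENNReal.ofReal_le_ofReal (pow_le_one₀ (by positivity) (inv_le_one_of_one_le₀ ?_))
      linarith [Real.pi_gt_three]
    rw [productFourier, enorm_mul]
    refine (mul_le_mul' hc (enorm_integral_le_lintegral_enorm _)).trans (le_of_eq ?_)
    simp only [one_mul, enorm_mul, LinearIsometryEquiv.enorm_map, hG]
  refine le_trans ?_ (weightedNorm_inv_le_of_dual hw₃.continuous hw₃.pos hGm fun h hh => ?_)
  · refine ENNReal.rpow_le_rpow (lintegral_mono fun p => ?_) (by norm_num)
    exact mul_le_mul_right (pow_le_pow_left' (hle p) 2) _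
  · rw [mul_assoc]
    refine le_of_eq_of_le (lintegral_congr fun R => ?_)
      (hT.lintegral_translate_le hf.enorm hg.enorm hh)
    rw [← lintegral_mul_const _ (by fun_prop)]

theorem integral_schwartz_product (hκ : FourierCompatible κ e) (hT : TrilinearBound e w₁ w₂ w₃ C)
    (hw₁ : IsPolyWeight w₁) (hw₂ : IsPolyWeight w₂) (hw₃ : IsPolyWeight w₃)
    (a b ψ : 𝓢(ℝ × ℝ, ℂ)) :
    ∫ x, a x * κ (b x) * fourierST ψ x = ((2 * Real.pi)⁻¹ ^ 2 : ℝ) *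
      ∫ z, triIntegrand κ e (fourierST a) (fourierST b) ψ z ∂(volume.prod volume) := by
  have h : Integrable (triIntegrand κ e (fourierST a) (fourierST b) ψ) (volume.prod volume) :=
    hT.integrable (fourierST a).continuous.measurable (fourierST b).continuous.measurable
      ψ.continuous.measurable (weightedNorm_schwartz_lt_top hw₁ _)
      (weightedNorm_schwartz_lt_top hw₂ _) (weightedNorm_schwartz_lt_top hw₃ _)
  rw [integral_mul_mul_fourierST hκ, integral_prod_symm _ h]
  congr 1
  refine integral_congr_ae (Eventually.of_forall fun Q => ?_)
  simp only
  rw [← integral_add_right_eq_self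
    (fun R => triIntegrand κ e (fourierST a) (fourierST b) ψ (R, Q)) (e • Q)]
  simp only [triIntegrand, add_sub_cancel_right]

/-- Continuity of the trilinear form in its first two arguments, along sequences. -/
theorem TrilinearBound.tendsto (hT : TrilinearBound e w₁ w₂ w₃ C) {fk gk : ℕ → ℝ × ℝ → ℂ}
    (hf : Measurable f) (hg : Measurable g) (hψ : Measurable ψ)
    (hfk : ∀ k, Measurable (fk k)) (hgk : ∀ k, Measurable (gk k))
    (hf' : weightedNorm w₁ (fun p => ‖f p‖ₑ) < ∞) (hg' : weightedNorm w₂ (fun p => ‖g p‖ₑ) < ∞)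
    (hψ' : weightedNorm w₃ (fun p => ‖ψ p‖ₑ) < ∞)
    (hfl : Tendsto (fun k => weightedNorm w₁ fun p => ‖(fk k - f) p‖ₑ) atTop (𝓝 0))
    (hgl : Tendsto (fun k => weightedNorm w₂ fun p => ‖(gk k - g) p‖ₑ) atTop (𝓝 0)) :
    Tendsto (fun k => ∫ z, triIntegrand κ e (fk k) (gk k) ψ z ∂(volume.prod volume)) atTop
      (𝓝 (∫ z, triIntegrand κ e f g ψ z ∂(volume.prod volume))) := by
  set N₁ := fun k => weightedNorm w₁ fun p => ‖(fk k - f) p‖ₑ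
  set N₂ := fun k => weightedNorm w₂ fun p => ‖(gk k - g) p‖ₑ
  set A := weightedNorm w₁ fun p => ‖f p‖ₑ
  set B := weightedNorm w₂ fun p => ‖g p‖ₑ
  set D := weightedNorm w₃ fun p => ‖ψ p‖ₑ
  rw [tendsto_iff_edist_tendsto_0]
  have hbound : ∀ᶠ k in atTop, edist (∫ z, triIntegrand κ e (fk k) (gk k) ψ z ∂(volume.prod volume))
      (∫ z, triIntegrand κ e f g ψ z ∂(volume.prod volume)) ≤
      C * (N₁ k * N₂ k * D) + C * (N₁ k * B * D) + C * (A * N₂ k * D) := by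
    filter_upwards [hfl.eventually_lt_const ENNReal.zero_lt_top,
      hgl.eventually_lt_const ENNReal.zero_lt_top] with k h1 h2
    have mδ : Measurable (fk k - f) := (hfk k).sub hf
    have mη : Measurable (gk k - g) := (hgk k).sub hg
    have i₀ := hT.integrable (κ := κ) hf hg hψ hf' hg' hψ'
    have i₁ := hT.integrable (κ := κ) mδ mη hψ h1 h2 hψ'
    have i₂ := hT.integrable (κ := κ) mδ hg hψ h1 hg' hψ'
    have i₃ := hT.integrable (κ := κ) hf mη hψ hf' h2 hψ'
    have esum : triIntegrand κ e (fk k) (gk k) ψ = triIntegrand κ e (fk k - f) (gk k - g) ψ +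
        triIntegrand κ e (fk k - f) g ψ + triIntegrand κ e f (gk k - g) ψ +
        triIntegrand κ e f g ψ := by
      ext z
      simp only [triIntegrand, Pi.add_apply, Pi.sub_apply, map_sub]
      ring
    have bd : ∀ {u v : ℝ × ℝ → ℂ}, Measurable u → Measurable v →
        ‖∫ z, triIntegrand κ e u v ψ z ∂(volume.prod volume)‖ₑ ≤
        C * (weightedNorm w₁ (fun p => ‖u p‖ₑ) * weightedNorm w₂ (fun p => ‖v p‖ₑ) * D) :=
      fun hu hv => (enorm_integral_le_lintegral_enorm _).trans (hT.lintegral_enorm_le hu hv hψ)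
    rw [esum, integral_add' ((i₁.add i₂).add i₃) i₀, integral_add' (i₁.add i₂) i₃,
      integral_add' i₁ i₂, edist_eq_enorm_sub, add_sub_cancel_right]
    exact (enorm_add_le _ _).trans (add_le_add ((enorm_add_le _ _).trans
      (add_le_add (bd mδ mη) (bd mδ hg))) (bd hf mη))
  refine tendsto_of_tendsto_of_tendsto_of_le_of_le' tendsto_const_nhds ?_
    (Eventually.of_forall fun k => zero_le) hbound
  have hC : (C : ℝ≥0∞) ≠ ∞ := ENNReal.coe_ne_top
  have t₁ : Tendsto (fun k => C * (N₁ k * N₂ k * D)) atTop (𝓝 (C * (0 * 0 * D))) :=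
    ENNReal.Tendsto.const_mul (ENNReal.Tendsto.mul_const (ENNReal.Tendsto.mul hfl
      (Or.inr ENNReal.zero_ne_top) hgl (Or.inr ENNReal.zero_ne_top)) (Or.inr hψ'.ne)) (Or.inr hC)
  have t₂ : Tendsto (fun k => C * (N₁ k * B * D)) atTop (𝓝 (C * (0 * B * D))) :=
    ENNReal.Tendsto.const_mul (ENNReal.Tendsto.mul_const (ENNReal.Tendsto.mul_const hfl
      (Or.inr hg'.ne)) (Or.inr hψ'.ne)) (Or.inr hC)
  have t₃ : Tendsto (fun k => C * (A * N₂ k * D)) atTop (𝓝 (C * (A * 0 * D))) :=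
    ENNReal.Tendsto.const_mul (ENNReal.Tendsto.mul_const (ENNReal.Tendsto.const_mul hgl
      (Or.inr hf'.ne)) (Or.inr hψ'.ne)) (Or.inr hC)
  simpa using (t₁.add t₂).add t₃

/-- A trilinear estimate on the Fourier side defines the product by extension by continuity, and
bounds its Fourier transform in the norm with the inverse of the third weight. -/
theorem TrilinearBound.exists_isProduct (hκ : FourierCompatible κ e)
    (hT : TrilinearBound e w₁ w₂ w₃ C) (hw₁ : IsPolyWeight w₁) (hw₂ : IsPolyWeight w₂)
    (hw₃ : IsPolyWeight w₃) {u v : 𝓢'(ℝ × ℝ, ℂ)} (hu : fourierWeightedNorm w₁ u < ∞)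
    (hv : fourierWeightedNorm w₂ v < ∞) :
    ∃ (w : 𝓢'(ℝ × ℝ, ℂ)) (F : ℝ × ℝ → ℂ),
      IsProduct (fun y z => y * κ z) (fourierWeightedNorm w₁) (fourierWeightedNorm w₂) u v w ∧
      HasFourier w F ∧ weightedNorm (fun p => (w₃ p)⁻¹) (fun p => ‖F p‖ₑ) ≤
        C * fourierWeightedNorm w₁ u * fourierWeightedNorm w₂ v := by
  obtain ⟨f, hfm, hf⟩ := exists_hasFourier_of_norm_lt_top hu
  obtain ⟨g, hgm, hg⟩ := exists_hasFourier_of_norm_lt_top hv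
  have hf' := hu
  have hg' := hv
  rw [fourierWeightedNorm_eq hf] at hf'
  rw [fourierWeightedNorm_eq hg] at hg'
  have mf := hfm.measurable
  have mg := hgm.measurable
  have hint : ∀ ψ : 𝓢(ℝ × ℝ, ℂ), Integrable (triIntegrand κ e f g ψ) (volume.prod volume) :=
    fun ψ => hT.integrable mf mg ψ.continuous.measurable hf' hg'
      (weightedNorm_schwartz_lt_top hw₃ ψ)
  let ℓ : 𝓢(ℝ × ℝ, ℂ) →ₗ[ℂ] ℂ :=
    { toFun := fun ψ => ∫ z, triIntegrand κ e f g ψ z ∂(volume.prod volume)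
      map_add' := fun ψ χ => by
        rw [← integral_add (hint ψ) (hint χ)]
        congr 1; ext z
        simp only [triIntegrand, add_apply]; ring
      map_smul' := fun c ψ => by
        rw [RingHom.id_apply, smul_eq_mul, ← integral_const_mul]
        congr 1; ext z
        simp only [triIntegrand, smul_apply, smul_eq_mul]; ring }
  obtain ⟨L, hL⟩ := exists_clm_of_le_weightedNorm hw₃ ℓ
    (K := C * (weightedNorm w₁ (fun p => ‖f p‖ₑ) * weightedNorm w₂ fun p => ‖g p‖ₑ))
    (ENNReal.mul_ne_top ENNReal.coe_ne_top (ENNReal.mul_ne_top hf'.ne hg'.ne)) fun ψ => by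
      refine (enorm_integral_le_lintegral_enorm _).trans
        ((hT.lintegral_enorm_le mf mg ψ.continuous.measurable).trans (le_of_eq ?_))
      ring
  let w : 𝓢'(ℝ × ℝ, ℂ) := ContinuousLinearMap.toPointwiseConvergenceCLM _ _ _ _
    ((((2 * Real.pi)⁻¹ ^ 2 : ℝ) : ℂ) • L.comp fourierSTInv)
  have hw : ∀ ψ : 𝓢(ℝ × ℝ, ℂ), w (fourierST ψ) =
      ((2 * Real.pi)⁻¹ ^ 2 : ℝ) * ∫ z, triIntegrand κ e f g ψ z ∂(volume.prod volume) := by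
    intro ψ
    change (((2 * Real.pi)⁻¹ ^ 2 : ℝ) : ℂ) * L (fourierSTInv (fourierST ψ)) = _
    rw [fourierSTInv_fourierST, hL]
    rfl
  refine ⟨w, productFourier κ e f g, ⟨exists_schwartz_tendsto hw₁ hu,
    exists_schwartz_tendsto hw₂ hv, fun a b ha hb φ => ?_⟩, ⟨?_, fun ψ => ?_⟩, ?_⟩
  · rw [← fourierST_fourierSTInv φ]
    set ψ := fourierSTInv φ
    rw [hw]
    simp only [integral_schwartz_product hκ hT hw₁ hw₂ hw₃]
    refine Tendsto.const_mul _ ?_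
    have ha' : ∀ k, fourierWeightedNorm w₁ ((a k : 𝓢'(ℝ × ℝ, ℂ)) - u) =
        weightedNorm w₁ fun p => ‖(⇑(fourierST (a k)) - f) p‖ₑ :=
      fun k => fourierWeightedNorm_eq ((hasFourier_schwartz (a k)).sub hf)
    have hb' : ∀ k, fourierWeightedNorm w₂ ((b k : 𝓢'(ℝ × ℝ, ℂ)) - v) =
        weightedNorm w₂ fun p => ‖(⇑(fourierST (b k)) - g) p‖ₑ :=
      fun k => fourierWeightedNorm_eq ((hasFourier_schwartz (b k)).sub hg)
    simp only [ha'] at ha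
    simp only [hb'] at hb
    exact hT.tendsto mf mg ψ.continuous.measurable
      (fun k => (fourierST (a k)).continuous.measurable)
      (fun k => (fourierST (b k)).continuous.measurable) hf' hg'
      (weightedNorm_schwartz_lt_top hw₃ ψ) ha hb
  · exact (stronglyMeasurable_productFourier mf mg).aestronglyMeasurable
  · rw [hw]
    exact integral_productFourier_mul (hint ψ)
  · rw [fourierWeightedNorm_eq hf, fourierWeightedNorm_eq hg, mul_assoc]
    exact hT.weightedNorm_productFourier_le hw₃ mf mg

end

/-! ### The Schrödinger and wave weights -/

theorem isPolyWeight_weightS {α : ℝ} (hα : α ≤ 1 / 2) :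
    IsPolyWeight (weightS α) := by
  refine ⟨?_, fun p => Real.rpow_pos_of_pos (bracket_pos _) _, 2, 1, fun p => ?_⟩
  · exact Continuous.rpow_const (continuous_bracket.comp (by fun_prop)) fun p =>
      Or.inl (bracket_pos _).ne'
  · have h1 : |p.1| ≤ ‖p‖ := norm_fst_le p
    have h2 : |p.2| ≤ ‖p‖ := norm_snd_le p
    calc weightS α p ≤ bracket (p.2 + |p.1| ^ 2) ^ (1 : ℝ) :=
          Real.rpow_le_rpow_of_exponent_le (one_le_bracket _) (by linarith)
      _ ≤ 1 + |p.2 + |p.1| ^ 2| := by rw [Real.rpow_one]; exact bracket_le _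
      _ ≤ 1 + (|p.2| + |p.1| ^ 2) := by
          gcongr
          exact (abs_add_le _ _).trans_eq (by rw [abs_of_nonneg (sq_nonneg |p.1|)])
      _ ≤ 1 * (1 + ‖p‖) ^ 2 := by nlinarith [abs_nonneg p.1, norm_nonneg p]

theorem isPolyWeight_weightW (ε : ℝ) {α : ℝ} (hα : α ≤ 1 / 2) : IsPolyWeight (weightW ε α) := by
  have hp : ∀ x θ : ℝ, 0 < bracket x ^ θ := fun x θ => Real.rpow_pos_of_pos (bracket_pos _) _
  refine ⟨?_, fun p => mul_pos (hp _ _) (hp _ _), 1, 1 + |ε|, fun p => ?_⟩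
  · refine Continuous.mul ?_ ?_ <;>
    exact Continuous.rpow_const (continuous_bracket.comp (by fun_prop)) fun p =>
      Or.inl (bracket_pos _).ne'
  · have h1 : |p.1| ≤ ‖p‖ := norm_fst_le p
    have h2 : |p.2| ≤ ‖p‖ := norm_snd_le p
    calc weightW ε α p ≤ 1 * bracket (p.2 + ε * p.1) ^ (1 : ℝ) := by
          refine mul_le_mul ?_ ?_ (hp _ _).le zero_le_one
          · exact Real.rpow_le_one_of_one_le_of_nonpos (one_le_bracket _) (by norm_num)
          · exact Real.rpow_le_rpow_of_exponent_le (one_le_bracket _) (by linarith)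
      _ ≤ 1 + |p.2 + ε * p.1| := by rw [Real.rpow_one, one_mul]; exact bracket_le _
      _ ≤ 1 + (|p.2| + |ε| * |p.1|) := by
          gcongr
          exact (abs_add_le _ _).trans_eq (by rw [abs_mul])
      _ ≤ (1 + |ε|) * (1 + ‖p‖) ^ 1 := by
          have h4 := mul_le_mul_of_nonneg_left h1 (abs_nonneg ε)
          linarith [abs_nonneg ε]

theorem inv_weightS (α : ℝ) (p : ℝ × ℝ) :
    (weightS α p)⁻¹ = bracket (p.2 + |p.1| ^ 2) ^ (2 * -α) := by
  rw [weightS, mul_neg, Real.rpow_neg (bracket_pos _).le]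

/-- The weight of `X^{W±}_{-1/2,-α}` applied to `∂ₓ` is at most the reciprocal of the weight of
`X^{W±}_{-1/2,α}`, because `|ξ|² ≤ ⟨ξ⟩²`. -/
theorem weightW_neg_mul_sq_le (ε α : ℝ) (p : ℝ × ℝ) :
    weightW ε (-α) p * p.1 ^ 2 ≤ (weightW ε α p)⁻¹ := by
  have h1 : p.1 ^ 2 ≤ bracket p.1 ^ 2 := sq_le_sq' (by
    linarith [neg_abs_le p.1, abs_le_bracket p.1]) ((le_abs_self _).trans (abs_le_bracket _))
  have hb := bracket_pos p.1
  rw [weightW, weightW, Real.rpow_neg_one, mul_neg,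
    Real.rpow_neg (bracket_pos _).le, mul_inv, inv_inv, mul_right_comm]
  refine mul_le_mul_of_nonneg_right ?_ (inv_nonneg.2 (Real.rpow_nonneg (bracket_pos _).le _))
  rw [inv_mul_le_iff₀ hb]
  nlinarith

theorem fourierWeightedNorm_partialX_le {ε α : ℝ} {z : 𝓢'(ℝ × ℝ, ℂ)} {F : ℝ × ℝ → ℂ}
    (h : HasFourier z F) :
    normXW ε (-α) (partialX z) ≤ weightedNorm (fun p => (weightW ε α p)⁻¹) fun p => ‖F p‖ₑ := by
  refine (fourierWeightedNorm_eq (hasFourier_partialX h)).trans_le ?_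
  refine ENNReal.rpow_le_rpow (lintegral_mono fun p => ?_) (by norm_num)
  have e1 : ‖Complex.I * p.1 * F p‖ₑ ^ 2 = ENNReal.ofReal (p.1 ^ 2) * ‖F p‖ₑ ^ 2 := by
    rw [enorm_mul, enorm_mul, mul_pow, mul_pow, ← ofReal_norm Complex.I, Complex.norm_I,
      ← ofReal_norm (p.1 : ℂ), Complex.norm_real, Real.norm_eq_abs, ← sq_abs p.1,
      ENNReal.ofReal_pow (abs_nonneg _), ENNReal.ofReal_one, one_pow, one_mul]
  simp only [e1]
  rw [← mul_assoc, ← ENNReal.ofReal_mul' (sq_nonneg _)]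
  exact mul_le_mul_left (ENNReal.ofReal_le_ofReal (weightW_neg_mul_sq_le ε α p)) _

/-- Exchanging the first and the third factor reverses the sign in the frequency relation: the
estimate that bounds `n u` against a Schrödinger wave bounds `u₁ ū₂` against a wave. -/
theorem TrilinearBound.rotate {w₁ w₂ w₃ : ℝ × ℝ → ℝ} {C : ℝ≥0} (hT : TrilinearBound 1 w₁ w₂ w₃ C) :
    TrilinearBound (-1) w₃ w₂ w₁ C := by
  intro f g h hf hg hh
  refine le_of_eq_of_le (lintegral_congr fun Q => ?_)
    ((hT h g f hh hg hf).trans_eq (by ring))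
  rw [← lintegral_add_right_eq_self _ Q]
  refine lintegral_congr fun P => ?_
  simp only [neg_smul, one_smul, add_neg_cancel_right]
  ring

end Zakharov

end

theorem lemma3p1 :
    (∀ b b₁ c₁ : ℝ, 1 / 4 < b → b < 1 / 2 → 1 / 4 < b₁ → b₁ < 1 / 2 → 1 / 4 < c₁ → c₁ < 1 / 2 →
      1 ≤ b + b₁ + c₁ →
      ∃ C : ℝ≥0, ∀ ε : ℝ, (ε = 1 ∨ ε = -1) → ∀ n u : 𝓢'(ℝ × ℝ, ℂ),
        Zakharov.normXW ε b n < ∞ → Zakharov.normXS b₁ u < ∞ →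
        ∃ w : 𝓢'(ℝ × ℝ, ℂ), Zakharov.IsWaveSchrodingerProduct ε b b₁ n u w ∧
          Zakharov.normXS (-c₁) w ≤ C * Zakharov.normXW ε b n * Zakharov.normXS b₁ u) ∧
    (∀ b₁ c : ℝ, 1 / 4 < b₁ → b₁ < 1 / 2 → 1 / 4 < c → c < 1 / 2 → 1 ≤ 2 * b₁ + c →
      ∃ C : ℝ≥0, ∀ ε : ℝ, (ε = 1 ∨ ε = -1) → ∀ u₁ u₂ : 𝓢'(ℝ × ℝ, ℂ),
        Zakharov.normXS b₁ u₁ < ∞ → Zakharov.normXS b₁ u₂ < ∞ →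
        ∃ w : 𝓢'(ℝ × ℝ, ℂ), Zakharov.IsSchrodingerConjProduct b₁ u₁ u₂ w ∧
          Zakharov.normXW ε (-c) (Zakharov.partialX w) ≤
            C * Zakharov.normXS b₁ u₁ * Zakharov.normXS b₁ u₂) := by
  open Zakharov in
  refine ⟨fun b b₁ c₁ hb hb' hb₁ hb₁' hc hc' hs => ?_, fun b₁ c hb₁ hb₁' hc hc' hs => ?_⟩
  · obtain ⟨C, hC⟩ := exists_trilinear_le hb hb' hb₁ hb₁' hc hc' hs
    refine ⟨C, fun ε _ n u hn hu => ?_⟩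
    have hT : TrilinearBound 1 (weightW ε b) (weightS b₁) (weightS c₁) C := fun f g h => by
      simpa only [one_smul] using hC ε f g h
    obtain ⟨w, F, hw, hF, hle⟩ := hT.exists_isProduct fourierCompatible_refl
      (isPolyWeight_weightW ε hb'.le) (isPolyWeight_weightS hb₁'.le)
      (isPolyWeight_weightS hc'.le) hn hu
    refine ⟨w, hw, ((fourierWeightedNorm_eq hF).trans ?_).trans_le hle⟩
    simp only [inv_weightS]
  · obtain ⟨C, hC⟩ := exists_trilinear_le hc hc' hb₁ hb₁' hb₁ hb₁' (by linarith)
    refine ⟨C, fun ε _ u₁ u₂ h₁ h₂ => ?_⟩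
    have hT : TrilinearBound 1 (weightW ε c) (weightS b₁) (weightS b₁) C := fun f g h => by
      simpa only [one_smul] using hC ε f g h
    have hS := isPolyWeight_weightS hb₁'.le
    obtain ⟨w, F, hw, hF, hle⟩ := hT.rotate.exists_isProduct fourierCompatible_conj hS hS
      (isPolyWeight_weightW ε hc'.le) h₁ h₂
    exact ⟨w, hw, (fourierWeightedNorm_partialX_le hF).trans hle⟩
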